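/- Consider two interconnected impulsive systems $$\dot x_i(t)=f_i(x_1(t),x_2(t),u_i(t)),\ t\notin\widehat{\mathbb T}_1\cup\widehat{\mathbb T}_2,\qquad x_i(t)=\hat g_i(x_1^-(t),x_2^-(t),u_i^-(t)),\ t\in\widehat{\mathbb T}_i,\qquad i=1,2,$$ with $x_i\in\mathbb R^{N_i}$, $u_i\in\mathbb R^{M_i}$, $f_i$ locally Lipschitz, impulse sequences $\widehat{\mathbb T}_i\subset(t_0,\infty)$ (strictly increasing, without finite accumulation points), inputs that are Lebesgue measurable, locally bounded, right-continuous and have left limits, and $x^-$ the left limit. With $x=(x_1,x_2)$, $u=(u_1,u_2)$ (Euclidean norms throughout) write it as one system $\dot x=f(x,u)$, $f=(f_1,f_2)$, with three jump maps, $x(t)=g_i(x^-(t),u^-(t))$ for $t\in\mathbb T_i$, where $$g_1(x,u)=(\hat g_1(x,u_1),x_2),\quad g_2(x,u)=(x_1,\hat g_2(x,u_2)),\quad g_3(x,u)=(\hat g_1(x,u_1),\hat g_2(x,u_2)),$$ $\mathbb T_1=\widehat{\mathbb T}_1\setminus\widehat{\mathbb T}_2$, $\mathbb T_2=\widehat{\mathbb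 T}_2\setminus\widehat{\mathbb T}_1$, $\mathbb T_3=\widehat{\mathbb T}_1\cap\widehat{\mathbb T}_2$. Suppose that for $(i,j)=(1,2),(2,1)$ the function $V_i:\mathbb R^{N_i}\to[0,\infty)$ is continuous, positive definite, proper, and locally Lipschitz on $\mathbb R^{N_i}\setminus\{0\}$, and that there are $c_i\in\mathbb R$, $\hat d_i\in\mathbb R\setminus\{0\}$, $\gamma_{ij}>0$ and $\gamma_i\in\mathcal K_\infty$ such that for almost every $x$ and all $u_i$ $$V_i(x_i)\ge\max\{\gamma_{ij}V_j(x_j),\gamma_i(|u_i|)\}\ \Longrightarrow\ \nabla V_i(x_i)\cdot f_i(x,u_i)\le -c_iV_i(x_i),$$ and for all $x$, $u_i$ $$V_i(\hat g_i(x,u_i))\le\max\{e^{-\hat d_i}V_i(x_i),\gamma_{ij}V_j(x_j),\gamma_i(|u_i|)\}.$$ If $\gamma_{12}\gamma_{21}<1$, then there is $s_1>0$ such that for every $\varepsilon>0$, with $$V(x):=\max\{\tfrac1{s_1}V_1(x_1),V_2(x_2)\},\qquad c:=\min\{c_1,c_2\},$$ $$d_1:=\min\{\hat d_1,-\ln(\tfrac1{s_1}\gamma_{12}),-\varepsilon\},\quad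 d_2:=\min\{\hat d_2,-\ln\gamma_{21},-\varepsilon\},\quad d_3:=\min\{\hat d_1,\hat d_2,-\ln(\tfrac1{s_1}\gamma_{12}),-\ln\gamma_{21}\},$$ $$\gamma(r):=\max\{e^{d_1},e^{d_2},e^{d_3},1\}\max\{\tfrac1{s_1}\gamma_1(r),\gamma_2(r)\},$$ the following holds. (a) $V$ is a candidate exponential ISS-Lyapunov function for the whole system with rate coefficients $c,d_1,d_2,d_3$ and gain $\gamma\in\mathcal K_\infty$: $V$ is continuous, positive definite, radially unbounded, and locally Lipschitz on $\mathbb R^{N_1+N_2}\setminus\{0\}$ (and on all of $\mathbb R^{N_1+N_2}$ if $V_1$ and $V_2$ are locally Lipschitz everywhere), and whenever $V(x)\ge\gamma(|u|)$, $$\nabla V(x)\cdot f(x,u)\le -cV(x)\ \text{ for a.e. }x\text{ and all }u,\qquad V(g_i(x,u))\le e^{-d_i}V(x)\ \text{ for all }x,u,\ i=1,2,3.$$ (b) For all $\mu,\lambda>0$ the whole system is uniformly ISS over the class $\mathcal S[\mu,\lambda]$ of all families $(\mathbb T_1,\mathbb T_2,\mathbb T_3)$ of pairwise disjoint sets of impulse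 times in $(t_0,\infty)$, each finite in every bounded interval, satisfying the dwell-time condition $$-\sum_{i=1}^3 d_iN_i(t,s)-(c-\lambda)(t-s)\le\mu\qquad\text{for all }t\ge s\ge t_0,$$ where $N_i(t,s)$ is the number of elements of $\mathbb T_i$ in $(s,t]$. That is, there are $\beta\in\mathcal{KL}$ and $\bar\gamma\in\mathcal K_\infty$ such that for every family in $\mathcal S[\mu,\lambda]$, every initial state $x(t_0)$ and every input $u$, the solution exists on $[t_0,\infty)$ and satisfies $|x(t)|\le\max\{\beta(|x(t_0)|,t-t_0),\bar\gamma(\sup_{[t_0,t]}|u|)\}$ for all $t\ge t_0$. -/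

import Mathlib

open Set Filter Topology MeasureTheory
open scoped NNReal

/-! ### Comparison functions -/

/-- Class `𝒦`: continuous and strictly increasing on `[0, ∞)`, vanishing at `0`.
Only the values on `[0, ∞)` matter. -/
structure ClassK (α : ℝ → ℝ) : Prop where
  continuousOn : ContinuousOn α (Ici 0)
  strictMonoOn : StrictMonoOn α (Ici 0)
  map_zero : α 0 = 0

/-- Class `𝒦_∞`: unbounded functions of class `𝒦`. -/
structure ClassKInf (α : ℝ → ℝ) : Prop extends ClassK α where
  unbounded : Tendsto α atTop atTop

/-- Class `𝒦ℒ`. -/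
structure ClassKL (β : ℝ → ℝ → ℝ) : Prop where
  continuousOn : ContinuousOn (fun q : ℝ × ℝ => β q.1 q.2) (Ici 0 ×ˢ Ici 0)
  classK : ∀ t, 0 ≤ t → ClassK (fun r => β r t)
  antitoneOn : ∀ r, 0 ≤ r → AntitoneOn (β r) (Ici 0)
  tendsto_zero : ∀ r, 0 ≤ r → Tendsto (β r) atTop (𝓝 0)

/-! ### Impulsive systems with `p` jump maps -/

/-- The data of an impulsive system `ẋ = f(x,u)` for `t ∉ 𝕋`, `x = gᵢ(x⁻,u⁻)` for `t ∈ 𝕋ᵢ`,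
with `f` locally Lipschitz. -/
structure ImpulsiveSystem (E U : Type*) [NormedAddCommGroup E] [NormedAddCommGroup U]
    (p : ℕ) where
  /-- flow map -/
  f : E → U → E
  /-- jump maps -/
  g : Fin p → E → U → E
  f_locallyLipschitz : LocallyLipschitz (fun q : E × U => f q.1 q.2)

/-- Families of impulse times in `(t₀, ∞)`: `T i` is the set of times of the `i`-th jump map. The
sets are pairwise disjoint, and each has finitely many points in every bounded interval (that is,
it is the set of terms of a finite or infinite strictly increasing sequence without finite
accumulation point), so that impulses can be counted. -/
structure IsImpulseTimes {p : ℕ} (t₀ : ℝ) (T : Fin p → Set ℝ) : Prop where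
  subset : ∀ i, T i ⊆ Ioi t₀
  finite : ∀ i s t, (T i ∩ Ioc s t).Finite
  disjoint : ∀ i j, i ≠ j → Disjoint (T i) (T j)

/-- The number of impulse times in `(s, t]`. -/
noncomputable def impulseCount (T : Set ℝ) (t s : ℝ) : ℕ := (T ∩ Ioc s t).ncard

/-- Admissible inputs on `[t₀, ∞)`: Lebesgue measurable, locally bounded, right-continuous and with
left limits. -/
structure IsInput {U : Type*} [NormedAddCommGroup U] (t₀ : ℝ) (u : ℝ → U) : Prop where
  measurable : AEStronglyMeasurable u (volume.restrict (Ici t₀))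
  locallyBounded : ∀ t, t₀ ≤ t → ∃ C, ∀ s ∈ Icc t₀ t, ‖u s‖ ≤ C
  rightContinuous : ∀ t, t₀ ≤ t → ContinuousWithinAt u (Ici t) t
  leftLimit : ∀ t, t₀ < t → ∃ l, Tendsto u (𝓝[<] t) (𝓝 l)

/-- Supremum norm of a signal on the interval `[t₀, t]`. -/
noncomputable def supNorm {U : Type*} [NormedAddCommGroup U] (u : ℝ → U) (t₀ t : ℝ) : ℝ :=
  sSup ((fun s => ‖u s‖) '' Icc t₀ t)

namespace ImpulsiveSystem

variable {E U : Type*} [NormedAddCommGroup E] [NormedSpace ℝ E] [NormedAddCommGroup U] {p : ℕ}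

/-- `x` is a (global) solution on `[t₀, ∞)` for the impulse times `T` and the input `u`, with
`x(t₀) = x₀`: it is absolutely continuous on every interval `[a, b]` such that no impulse occurs in
`(a, b]`, it solves the differential equation almost everywhere, and at every impulse time it is
updated by the corresponding jump map, evaluated at the left limits of `x` and `u`. -/
structure IsSolution (Sys : ImpulsiveSystem E U p) (t₀ : ℝ) (T : Fin p → Set ℝ) (u : ℝ → U)
    (x₀ : E) (x : ℝ → E) : Prop where
  init : x t₀ = x₀
  absolutelyContinuous : ∀ a b, t₀ ≤ a → a ≤ b → Disjoint (⋃ i, T i) (Ioc a b) →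
    AbsolutelyContinuousOnInterval x a b
  flow : ∀ᵐ t : ℝ, t₀ < t → HasDerivAt x (Sys.f (x t) (u t)) t
  jump : ∀ i, ∀ t ∈ T i, ∃ xl ul, Tendsto x (𝓝[<] t) (𝓝 xl) ∧ Tendsto u (𝓝[<] t) (𝓝 ul) ∧
    x t = Sys.g i xl ul

/-- Input-to-state stability for the impulse times `T`, with given `β` and `γ`: for every initial
state and every input, the solution exists globally and satisfies the ISS estimate. -/
def SatisfiesISS (Sys : ImpulsiveSystem E U p) (t₀ : ℝ) (T : Fin p → Set ℝ) (β : ℝ → ℝ → ℝ)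
    (γ : ℝ → ℝ) : Prop :=
  ∀ (x₀ : E) (u : ℝ → U), IsInput t₀ u →
    (∃ x, Sys.IsSolution t₀ T u x₀ x) ∧
    ∀ x, Sys.IsSolution t₀ T u x₀ x → ∀ t, t₀ ≤ t →
      ‖x t‖ ≤ max (β ‖x₀‖ (t - t₀)) (γ (supNorm u t₀ t))

/-- Uniform ISS over a set `S` of families of impulse times: `β` and `γ` do not depend on the
family. -/
def UniformlyISS (Sys : ImpulsiveSystem E U p) (t₀ : ℝ) (S : Set (Fin p → Set ℝ)) : Prop :=
  ∃ (β : ℝ → ℝ → ℝ) (γ : ℝ → ℝ), ClassKL β ∧ ClassKInf γ ∧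
    ∀ T ∈ S, Sys.SatisfiesISS t₀ T β γ

end ImpulsiveSystem

/-- The class `𝒮[μ, λ]` of families of impulse times satisfying the dwell-time condition. -/
def dwellTimeClass {p : ℕ} (t₀ c : ℝ) (d : Fin p → ℝ) (μ lam : ℝ) : Set (Fin p → Set ℝ) :=
  {T | IsImpulseTimes t₀ T ∧ ∀ s t, t₀ ≤ s → s ≤ t →
    -(∑ i, d i * (impulseCount (T i) t s : ℝ)) - (c - lam) * (t - s) ≤ μ}

/-- Candidate exponential ISS-Lyapunov function with gain `γ` and rate coefficients `c`, `d i`.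
As for the subsystems, the Lipschitz property is required away from the origin. -/
structure IsCandidateExpISSLyapunov {E U : Type*} [NormedAddCommGroup E] [InnerProductSpace ℝ E]
    [FiniteDimensional ℝ E] [MeasurableSpace E] [BorelSpace E] [NormedAddCommGroup U] {p : ℕ}
    (Sys : ImpulsiveSystem E U p) (V : E → ℝ) (γ : ℝ → ℝ) (c : ℝ) (d : Fin p → ℝ) : Prop where
  continuous : Continuous V
  locallyLipschitzOn : LocallyLipschitzOn {0}ᶜ V
  map_zero : V 0 = 0
  pos : ∀ x, x ≠ 0 → 0 < V x
  radiallyUnbounded : Tendsto V (cocompact E) atTop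
  gain : ClassKInf γ
  flow : ∀ᵐ x : E, ∀ u : U, γ ‖u‖ ≤ V x → fderiv ℝ V x (Sys.f x u) ≤ -c * V x
  jump : ∀ (x : E) (u : U), γ ‖u‖ ≤ V x → ∀ i, V (Sys.g i x u) ≤ Real.exp (-d i) * V x

/-! ### Interconnections of two impulsive systems -/

/-- The product of two Euclidean spaces, with the Euclidean norm. -/
abbrev EuclideanProd (m n : ℕ) : Type :=
  WithLp 2 (EuclideanSpace ℝ (Fin m) × EuclideanSpace ℝ (Fin n))

/-- Two interconnected impulsive systems `ẋᵢ = fᵢ(x₁,x₂,uᵢ)`, with jumps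
`xᵢ = ĝᵢ(x₁⁻,x₂⁻,uᵢ⁻)` at the impulse times of the `i`-th subsystem. -/
structure InterconnectedSystem (N₁ N₂ M₁ M₂ : ℕ) where
  f₁ : EuclideanProd N₁ N₂ → EuclideanSpace ℝ (Fin M₁) → EuclideanSpace ℝ (Fin N₁)
  f₂ : EuclideanProd N₁ N₂ → EuclideanSpace ℝ (Fin M₂) → EuclideanSpace ℝ (Fin N₂)
  g₁ : EuclideanProd N₁ N₂ → EuclideanSpace ℝ (Fin M₁) → EuclideanSpace ℝ (Fin N₁)
  g₂ : EuclideanProd N₁ N₂ → EuclideanSpace ℝ (Fin M₂) → EuclideanSpace ℝ (Fin N₂)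
  f₁_locallyLipschitz : LocallyLipschitz
    (fun q : EuclideanProd N₁ N₂ × EuclideanSpace ℝ (Fin M₁) => f₁ q.1 q.2)
  f₂_locallyLipschitz : LocallyLipschitz
    (fun q : EuclideanProd N₁ N₂ × EuclideanSpace ℝ (Fin M₂) => f₂ q.1 q.2)

/-- The whole interconnection as a system with three jump maps: only the first subsystem jumps,
only the second one jumps, or both jump. With impulse times `T̂₁`, `T̂₂` of the subsystems, the
impulse times of the three maps are `T̂₁ \ T̂₂`, `T̂₂ \ T̂₁` and `T̂₁ ∩ T̂₂`; every family of three
disjoint sets arises so, from `T̂₁ = T₁ ∪ T₃` and `T̂₂ = T₂ ∪ T₃`. -/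
def InterconnectedSystem.toImpulsiveSystem {N₁ N₂ M₁ M₂ : ℕ}
    (Sys : InterconnectedSystem N₁ N₂ M₁ M₂) :
    ImpulsiveSystem (EuclideanProd N₁ N₂) (EuclideanProd M₁ M₂) 3 where
  f x u := WithLp.toLp 2 (Sys.f₁ x u.fst, Sys.f₂ x u.snd)
  g := ![fun x u => WithLp.toLp 2 (Sys.g₁ x u.fst, x.snd),
    fun x u => WithLp.toLp 2 (x.fst, Sys.g₂ x u.snd),
    fun x u => WithLp.toLp 2 (Sys.g₁ x u.fst, Sys.g₂ x u.snd)]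
  f_locallyLipschitz := by
    have hfst : LocallyLipschitz (fun q : EuclideanProd N₁ N₂ × EuclideanProd M₁ M₂ =>
        (q.1, q.2.fst)) :=
      LipschitzWith.prod_fst.locallyLipschitz.prodMk
        ((WithLp.fstL 2 ℝ (EuclideanSpace ℝ (Fin M₁))
          (EuclideanSpace ℝ (Fin M₂))).lipschitz.locallyLipschitz.comp
            LipschitzWith.prod_snd.locallyLipschitz)
    have hsnd : LocallyLipschitz (fun q : EuclideanProd N₁ N₂ × EuclideanProd M₁ M₂ =>
        (q.1, q.2.snd)) :=
      LipschitzWith.prod_fst.locallyLipschitz.prodMk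
        ((WithLp.sndL 2 ℝ (EuclideanSpace ℝ (Fin M₁))
          (EuclideanSpace ℝ (Fin M₂))).lipschitz.locallyLipschitz.comp
            LipschitzWith.prod_snd.locallyLipschitz)
    have h := (Sys.f₁_locallyLipschitz.comp hfst).prodMk (Sys.f₂_locallyLipschitz.comp hsnd)
    have hL : LocallyLipschitz (fun y : EuclideanSpace ℝ (Fin N₁) × EuclideanSpace ℝ (Fin N₂) =>
        WithLp.toLp 2 y) :=
      (WithLp.prodContinuousLinearEquiv 2 ℝ (EuclideanSpace ℝ (Fin N₁))
        (EuclideanSpace ℝ (Fin N₂))).symm.lipschitz.locallyLipschitz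
    exact hL.comp h

/-- `V` is an exponential ISS-Lyapunov function for one of the two subsystems, with rate
coefficients `c`, `d`, internal gain `γ` and external gain `γe`. Here `own` and `other` are the
projections of the whole state to the state of this subsystem and to the state of the other one,
`W` is the Lyapunov function of the other subsystem, and `f`, `g` are the flow and jump maps of this
subsystem. -/
structure IsSubsystemExpISSLyapunov {N₁ N₂ n m k : ℕ}
    (own : EuclideanProd N₁ N₂ → EuclideanSpace ℝ (Fin n))
    (other : EuclideanProd N₁ N₂ → EuclideanSpace ℝ (Fin m))
    (f g : EuclideanProd N₁ N₂ → EuclideanSpace ℝ (Fin k) → EuclideanSpace ℝ (Fin n))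
    (V : EuclideanSpace ℝ (Fin n) → ℝ) (W : EuclideanSpace ℝ (Fin m) → ℝ)
    (c d : ℝ) (γ γe : ℝ → ℝ) : Prop where
  continuous : Continuous V
  locallyLipschitzOn : LocallyLipschitzOn {0}ᶜ V
  map_zero : V 0 = 0
  pos : ∀ y, y ≠ 0 → 0 < V y
  proper : Tendsto V (cocompact _) atTop
  internalGain : ClassKInf γ
  externalGain : ClassKInf γe
  flow : ∀ᵐ x : EuclideanProd N₁ N₂, ∀ u, max (γ (W (other x))) (γe ‖u‖) ≤ V (own x) →
    fderiv ℝ V (own x) (f x u) ≤ -c * V (own x)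
  jump : ∀ x u, V (g x u) ≤
    max (Real.exp (-d) * V (own x)) (max (γ (W (other x))) (γe ‖u‖))

/-! Scale by `s₁ = √(γ₁₂ / γ₂₁)`. Both internal gains, measured in terms of `V = max (V₁ / s₁) V₂`,
then become `√(γ₁₂ γ₂₁) < 1`, so the subsystem that realises the maximum always satisfies the
premise on the other subsystem's state. At almost every point `V`, `V₁` and `V₂` are differentiable,
and the gradient of `V` equals that of a branch touching it from below
(`fderiv_apply_eq_of_touching`); this yields the flow inequality. At a jump each component that
jumps is bounded by its own rate or by a gain, and a component that stays put requires `d ≤ 0`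
(`jump_max_le`). The factor in front of the gain turns the resulting max-form jump estimate into the
implication form.

For stability, the gradient inequality holds only almost everywhere, while a trajectory may run
inside a null set. Fubini gives the decrease along almost every parallel segment, and continuity
extends it to every segment (`LipschitzWith.add_smul_le_of_ae_fderiv_le`). Right-continuity of the
input makes solutions right-differentiable at every time, so they follow such segments to first
order, and a fencing argument bounds `V` along flows (`flow_le`). Properness of `V` then excludes
blow-up, and solutions exist globally (`exists_flow`, `exists_isSolution`).

Along a solution the weight `exp (∑ dᵢ Nᵢ + c (t - t₀))` compensates every flow and every jump, so
the weighted `V` never exceeds its initial value or the weighted input level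
(`comp_solution_mul_exp_le`). The dwell-time condition says that this weight grows at least like
`exp (lam * t)` up to a factor `exp μ`, which gives the decay. Comparing `V` with the norm produces
`β` and the gain. -/

/-! ### Auxiliary results from real analysis -/

/-- Induction along an interval that contains finitely many exceptional points. -/
theorem interval_induction {D : Set ℝ} {P : ℝ → Prop} {a b : ℝ} (hab : a ≤ b)
    (hfin : (D ∩ Ioo a b).Finite) (ha : P a)
    (step : ∀ s t, a ≤ s → s < t → t ≤ b → Disjoint D (Ioo s t) → P s → P t) : P b := by
  -- Only exceptional points in the open interval are counted. Either endpoint may be exceptional,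
  -- so `step` must deal with an exceptional right end.
  suffices H : ∀ (n : ℕ) (a' : ℝ), a ≤ a' → a' ≤ b → (D ∩ Ioo a' b).ncard ≤ n → P a' → P b from
    H _ a le_rfl hab le_rfl ha
  intro n
  induction n with
  | zero =>
    intro a' haa' hb hn hP
    rcases hb.eq_or_lt with rfl | hb
    · exact hP
    have hf : (D ∩ Ioo a' b).Finite := hfin.subset (by gcongr)
    have he : D ∩ Ioo a' b = ∅ := (Set.ncard_eq_zero hf).1 (Nat.le_zero.1 hn)
    exact step a' b haa' hb le_rfl (Set.disjoint_iff_inter_eq_empty.2 he) hP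
  | succ n ih =>
    intro a' haa' hb hn hP
    rcases hb.eq_or_lt with rfl | hb
    · exact hP
    have hf : (D ∩ Ioo a' b).Finite := hfin.subset (by gcongr)
    rcases (D ∩ Ioo a' b).eq_empty_or_nonempty with he | hne
    · exact step a' b haa' hb le_rfl (Set.disjoint_iff_inter_eq_empty.2 he) hP
    obtain ⟨τ, hτ, hmin⟩ := hf.exists_minimal hne
    refine ih τ (haa'.trans hτ.2.1.le) hτ.2.2.le ?_ ?_
    · have hss : D ∩ Ioo τ b ⊂ D ∩ Ioo a' b := by
        refine ⟨by have := hτ.2.1.le; gcongr, fun h => ?_⟩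
        exact lt_irrefl _ (h hτ).2.1
      have := Set.ncard_lt_ncard hss hf
      omega
    · refine step a' τ haa' hτ.2.1 hτ.2.2.le ?_ hP
      rw [Set.disjoint_left]
      intro y hy hy'
      have := hmin (y := y) ⟨hy, hy'.1, hy'.2.trans hτ.2.2⟩ hy'.2.le
      exact absurd hy'.2 (not_lt.2 this)

/-- A fencing lemma in which the boundary has to be checked only at the points of contact. -/
theorem le_of_frequently_le_of_eq {f B : ℝ → ℝ} {a b : ℝ} (hf : ContinuousOn f (Icc a b))
    (hB : ContinuousOn B (Icc a b)) (ha : f a ≤ B a)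
    (h : ∀ x ∈ Ico a b, f x = B x → ∃ᶠ z in 𝓝[>] x, f z ≤ B z) : ∀ x ∈ Icc a b, f x ≤ B x := by
  change Icc a b ⊆ {x | f x ≤ B x}
  have A : ContinuousOn (fun x => (f x, B x)) (Icc a b) := hf.prodMk hB
  have hcl : IsClosed ({x | f x ≤ B x} ∩ Icc a b) := by
    rw [inter_comm]
    exact A.preimage_isClosed_of_isClosed isClosed_Icc OrderClosedTopology.isClosed_le'
  apply hcl.Icc_subset_of_forall_exists_gt ha
  rintro x ⟨hxB : f x ≤ B x, xab⟩ y hy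
  rcases hxB.lt_or_eq with hxB | hxB
  · refine nonempty_of_mem (inter_mem ?_ (Ioc_mem_nhdsGT hy))
    have : ∀ᶠ x in 𝓝[Icc a b] x, f x < B x :=
      A x (Ico_subset_Icc_self xab) (IsOpen.mem_nhds (isOpen_lt continuous_fst continuous_snd) hxB)
    have : ∀ᶠ x in 𝓝[>] x, f x < B x := nhdsWithin_le_of_mem (Icc_mem_nhdsGT_of_mem xab) this
    exact this.mono fun y => le_of_lt
  · obtain ⟨z, hz, hz'⟩ := ((h x xab hxB).and_eventually (Ioc_mem_nhdsGT hy)).exists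
    exact ⟨z, hz, hz'⟩

/-- For a null set, almost every line in a given direction meets it in a null set. -/
theorem ae_ae_add_smul {E : Type*} [NormedAddCommGroup E] [InnerProductSpace ℝ E]
    [FiniteDimensional ℝ E] [MeasurableSpace E] [BorelSpace E] {p : E → Prop}
    (hp : ∀ᵐ y : E, p y) (v : E) : ∀ᵐ y : E, ∀ᵐ s : ℝ, p (y + s • v) := by
  obtain ⟨S, hSp, hSm, hS⟩ : ∃ S : Set E, S ⊆ {y | p y} ∧ MeasurableSet S ∧ volume Sᶜ = 0 := by
    refine ⟨(toMeasurable volume {y | ¬ p y})ᶜ, ?_, (measurableSet_toMeasurable _ _).compl, ?_⟩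
    · intro y hy
      by_contra h
      exact hy (subset_toMeasurable _ _ h)
    · rw [compl_compl, measure_toMeasurable]
      exact ae_iff.1 hp
  have hm : MeasurableSet {q : E × ℝ | q.1 + q.2 • v ∈ S} := by
    have : Measurable (fun q : E × ℝ => q.1 + q.2 • v) := by fun_prop
    exact this hSm
  -- Each translation preserves Lebesgue measure; measurability of `S` then allows Fubini to
  -- exchange the two quantifiers.
  have h1 : ∀ᵐ s : ℝ, ∀ᵐ y : E, y + s • v ∈ S := by
    refine Eventually.of_forall fun s => ?_
    exact (measurePreserving_add_right volume (s • v)).quasiMeasurePreserving.ae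
      (show ∀ᵐ y : E, y ∈ S from hS)
  filter_upwards [(Measure.ae_ae_comm (p := fun (y : E) (s : ℝ) => y + s • v ∈ S) hm).2 h1] with y hy
  filter_upwards [hy] with s hs using hSp hs

/-- A Lipschitz function whose derivative in a direction is bounded above almost everywhere grows
at most at this rate along *every* segment in this direction. -/
theorem LipschitzWith.add_smul_le_of_ae_fderiv_le {E : Type*} [NormedAddCommGroup E]
    [InnerProductSpace ℝ E] [FiniteDimensional ℝ E] [MeasurableSpace E] [BorelSpace E]
    {V : E → ℝ} {K : ℝ≥0} (hV : LipschitzWith K V) {x v : E} {r m h : ℝ}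
    (hae : ∀ᵐ y : E, y ∈ Metric.ball x r → fderiv ℝ V y v ≤ m) (hh : 0 ≤ h) (hr : h * ‖v‖ < r) :
    V (x + h • v) ≤ V x + h * m := by
  have hae' := ae_ae_add_smul (hae.and hV.ae_differentiableAt) v
  -- The radius is reduced by the length of the segment, so that the segment from `y` stays where
  -- the derivative bound is available.
  have key : ∀ᵐ y : E, y ∈ Metric.ball x (r - h * ‖v‖) → V (y + h • v) ≤ V y + h * m := by
    filter_upwards [hae'] with y hy hyr
    have hlip : LipschitzWith (K * ‖v‖₊) (fun s : ℝ => V (y + s • v)) := by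
      refine hV.comp (LipschitzWith.of_dist_le_mul fun s t => ?_)
      rw [dist_add_left, dist_eq_norm, ← sub_smul, norm_smul, dist_eq_norm, mul_comm]
      rfl
    have hac : AbsolutelyContinuousOnInterval (fun s : ℝ => V (y + s • v)) 0 h :=
      (hlip.lipschitzOnWith).absolutelyContinuousOnInterval
    have hint := hac.integral_deriv_eq_sub
    have hle : ∫ s in (0 : ℝ)..h, deriv (fun s : ℝ => V (y + s • v)) s ≤ ∫ _ in (0 : ℝ)..h, m := by
      refine intervalIntegral.integral_mono_ae_restrict hh hac.intervalIntegrable_deriv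
        intervalIntegrable_const ?_
      refine (ae_restrict_iff' measurableSet_Icc).2 ?_
      filter_upwards [hy] with s hs hsh
      have hd : HasDerivAt (fun s : ℝ => V (y + s • v)) (fderiv ℝ V (y + s • v) v) s := by
        have h2 : HasDerivAt (fun s : ℝ => y + s • v) v s := by
          simpa using ((hasDerivAt_id s).smul_const v).const_add y
        exact hs.2.hasFDerivAt.comp_hasDerivAt s h2
      rw [hd.deriv]
      refine hs.1 ?_
      rw [Metric.mem_ball, dist_eq_norm] at hyr ⊢
      calc ‖y + s • v - x‖ = ‖(y - x) + s • v‖ := by congr 1; abel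
        _ ≤ ‖y - x‖ + s * ‖v‖ := by
          refine (norm_add_le _ _).trans_eq ?_
          rw [norm_smul, Real.norm_of_nonneg hsh.1]
        _ ≤ ‖y - x‖ + h * ‖v‖ := by gcongr; exact hsh.2
        _ < r := by linarith
    rw [hint] at hle
    simp at hle
    linarith
  -- A set of full measure is dense and the inequality is closed in `y`, hence it also holds at the
  -- given base point.
  have hd := Measure.dense_of_ae key
  have hcl : IsClosed {y | V (y + h • v) ≤ V y + h * m} := by
    have := hV.continuous
    exact isClosed_le (by fun_prop) (by fun_prop)
  have hmem : x ∈ closure (Metric.ball x (r - h * ‖v‖) ∩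
      {y | y ∈ Metric.ball x (r - h * ‖v‖) → V (y + h • v) ≤ V y + h * m}) :=
    hd.open_subset_closure_inter Metric.isOpen_ball (Metric.mem_ball_self (by linarith))
  exact closure_minimal (fun y hy => hy.2 hy.1) hcl hmem

/-- Every nondecreasing function that vanishes on `(-∞, 0]` and is continuous at `0` is dominated
by a function of class `𝒦_∞`. -/
theorem exists_classKInf_ge {φ : ℝ → ℝ} (hmono : Monotone φ) (h0 : ∀ r, r ≤ 0 → φ r = 0)
    (hc : ContinuousAt φ 0) : ∃ α, ClassKInf α ∧ ∀ r, 0 ≤ r → φ r ≤ α r := by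
  have hnn : ∀ r, 0 ≤ φ r := fun r => by
    rcases le_total r 0 with h | h
    · rw [h0 r h]
    · rw [← h0 0 le_rfl]; exact hmono h
  have hmeas : Measurable φ := hmono.measurable
  have hint : ∀ r, IntervalIntegrable (fun s => φ (r * s)) volume 1 2 := by
    intro r
    rcases le_total 0 r with h | h
    · exact (hmono.comp (monotone_id.const_mul h)).intervalIntegrable
    · exact (hmono.comp_antitone
        (fun s t hst => mul_le_mul_of_nonpos_left hst h)).intervalIntegrable
  -- Averaging over dilations smooths `φ`: its discontinuities are countable, so for `r ≠ 0` almost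
  -- every `s` avoids them. At `r = 0` continuity of `φ` at the origin is needed.
  have hIcont : Continuous fun r => ∫ s in (1 : ℝ)..2, φ (r * s) := by
    rw [continuous_iff_continuousAt]
    intro r
    refine intervalIntegral.continuousAt_of_dominated_interval
      (bound := fun _ => φ (2 * (|r| + 1))) ?_ ?_ intervalIntegrable_const ?_
    · exact Eventually.of_forall fun x => (by fun_prop : Measurable fun s => φ (x * s)).aestronglyMeasurable
    · have : ∀ᶠ x in 𝓝 r, x < |r| + 1 :=
        eventually_lt_nhds (lt_of_le_of_lt (le_abs_self r) (by linarith))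
      filter_upwards [this] with x hx
      refine Eventually.of_forall fun t ht => ?_
      rw [uIoc_of_le (by norm_num)] at ht
      rw [Real.norm_of_nonneg (hnn _)]
      refine hmono ?_
      have := abs_nonneg r
      nlinarith [ht.1, ht.2]
    · rcases eq_or_ne r 0 with rfl | hr
      · refine Eventually.of_forall fun t _ => ?_
        have : ContinuousAt φ (0 * t) := by simpa using hc
        exact ContinuousAt.comp (f := fun x : ℝ => x * t) this (by fun_prop)
      · have hcount : {t | ¬ ContinuousAt φ (r * t)}.Countable :=
          hmono.countable_not_continuousAt.preimage (mul_right_injective₀ hr)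
        have hae : ∀ᵐ t : ℝ, ContinuousAt φ (r * t) := by
          simpa using hcount.ae_notMem volume
        filter_upwards [hae] with t ht _
        exact ContinuousAt.comp (f := fun x : ℝ => x * t) ht (by fun_prop)
  have hge : ∀ r, 0 ≤ r → φ r ≤ ∫ s in (1 : ℝ)..2, φ (r * s) := by
    intro r hr
    have : ∫ _ in (1 : ℝ)..2, φ r ≤ ∫ s in (1 : ℝ)..2, φ (r * s) :=
      intervalIntegral.integral_mono_on (by norm_num) intervalIntegrable_const (hint r)
        fun s hs => hmono (by nlinarith [hs.1])
    refine le_trans (le_of_eq ?_) this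
    norm_num
  have hImono : ∀ r t, 0 ≤ r → r ≤ t →
      ∫ s in (1 : ℝ)..2, φ (r * s) ≤ ∫ s in (1 : ℝ)..2, φ (t * s) := fun r t hr hrt =>
    intervalIntegral.integral_mono_on (by norm_num) (hint r) (hint t)
      fun s hs => hmono (by nlinarith [hs.1])
  -- The summand `r` makes the monotone average strictly increasing and unbounded.
  refine ⟨fun r => r + ∫ s in (1 : ℝ)..2, φ (r * s), ⟨⟨?_, ?_, ?_⟩, ?_⟩, ?_⟩
  · exact (continuous_id.add hIcont).continuousOn
  · intro r hr t _ hrt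
    exact add_lt_add_of_lt_of_le hrt (hImono r t hr hrt.le)
  · simp [h0 0 le_rfl]
  · refine tendsto_atTop_mono' _ ?_ tendsto_id
    filter_upwards [eventually_ge_atTop 0] with r hr
    have := (hnn r).trans (hge r hr)
    simpa using this
  · intro r hr
    have := hge r hr
    simp only
    linarith

/-- The supremum of `q` over the sublevel set `p ≤ v` is monotone in `v`; `hbdd` makes it finite,
and `hsmall` makes it vanish for `v ≤ 0` and continuous at `0`. Inserting `0` into the set keeps the
supremum nonnegative, also over empty sublevel sets. -/
theorem exists_classKInf_comparison {X : Type*} {p q : X → ℝ} (hp : ∀ x, 0 ≤ p x)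
    (hbdd : ∀ v, ∃ M, ∀ x, p x ≤ v → q x ≤ M)
    (hsmall : ∀ ε, 0 < ε → ∃ δ, 0 < δ ∧ ∀ x, p x ≤ δ → q x ≤ ε) :
    ∃ α, ClassKInf α ∧ ∀ x, q x ≤ α (p x) := by
  let S : ℝ → Set ℝ := fun v => insert 0 (q '' {x | p x ≤ v})
  have hSb : ∀ v, BddAbove (S v) := by
    intro v
    obtain ⟨M, hM⟩ := hbdd v
    refine ⟨max 0 M, ?_⟩
    rintro _ (rfl | ⟨x, hx, rfl⟩)
    · exact le_max_left _ _
    · exact (hM x hx).trans (le_max_right _ _)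
  have hSn : ∀ v, (S v).Nonempty := fun v => ⟨0, mem_insert _ _⟩
  have hS0 : ∀ v, 0 ≤ sSup (S v) := fun v => le_csSup (hSb v) (mem_insert _ _)
  have hmono : Monotone fun v => sSup (S v) := fun v w hvw =>
    csSup_le_csSup (hSb w) (hSn v)
      (insert_subset_insert (image_mono fun x (hx : p x ≤ v) => hx.trans hvw))
  have hle : ∀ ε, 0 < ε → ∃ δ, 0 < δ ∧ ∀ v, v ≤ δ → sSup (S v) ≤ ε := by
    intro ε hε
    obtain ⟨δ, hδ, h⟩ := hsmall ε hε
    refine ⟨δ, hδ, fun v hv => csSup_le (hSn v) ?_⟩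
    rintro _ (rfl | ⟨x, hx, rfl⟩)
    · exact hε.le
    · exact h x (le_trans hx hv)
  have h0 : ∀ v, v ≤ 0 → sSup (S v) = 0 := by
    intro v hv
    refine le_antisymm (le_of_forall_pos_le_add fun ε hε => ?_) (hS0 v)
    obtain ⟨δ, hδ, h⟩ := hle ε hε
    simpa using h v (hv.trans hδ.le)
  obtain ⟨α, hα, hge⟩ := exists_classKInf_ge hmono h0 (by
    rw [ContinuousAt, h0 0 le_rfl, Metric.tendsto_nhds]
    intro ε hε
    obtain ⟨δ, hδ, h⟩ := hle (ε / 2) (by linarith)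
    filter_upwards [eventually_lt_nhds hδ] with v hv
    rw [Real.dist_eq, sub_zero, abs_of_nonneg (hS0 v)]
    linarith [h v hv.le])
  exact ⟨α, hα, fun x => (le_csSup (hSb _) (mem_insert_of_mem _ ⟨x, show p x ≤ p x from le_rfl, rfl⟩)).trans
    (hge _ (hp x))⟩

/-- Existence of Carathéodory solutions for a globally Lipschitz right-hand side. -/
theorem exists_integral_solution {E : Type*} [NormedAddCommGroup E] [NormedSpace ℝ E]
    [CompleteSpace E] {F : ℝ → E → E} {K : ℝ≥0} {a b C : ℝ} (hab : a ≤ b)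
    (hF : ∀ t, LipschitzWith K (F t))
    (hmeas : ∀ y : ℝ → E, Continuous y →
      AEStronglyMeasurable (fun t => F t (y t)) (volume.restrict (Icc a b)))
    (hC : ∀ t ∈ Icc a b, ‖F t 0‖ ≤ C) (x₀ : E) :
    ∃ y : ℝ → E, Continuous y ∧ ∀ t ∈ Icc a b, y t = x₀ + ∫ s in a..t, F s (y s) := by
  -- Exponential weighting: in the unknown `v = exp (-L (t - a)) y` the Picard operator has
  -- Lipschitz constant at most `K / L ≤ 1 / 2` on the whole interval, whatever its length.
  set L : ℝ := 2 * K + 1 with hL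
  have hK0 : (0 : ℝ) ≤ K := K.2
  have hLpos : 0 < L := by positivity
  let ext : C(Icc a b, E) → ℝ → E := fun v s => Real.exp (L * (s - a)) • v (projIcc a b hab s)
  have hext : ∀ v, Continuous (ext v) := fun v => by
    have := v.continuous.comp (continuous_projIcc (a := a) (b := b) (h := hab))
    exact (by fun_prop : Continuous fun s => Real.exp (L * (s - a))).smul this
  have hint : ∀ y : ℝ → E, Continuous y → IntegrableOn (fun s => F s (y s)) (Icc a b) := by
    intro y hy
    obtain ⟨B, hB⟩ := isCompact_Icc.exists_bound_of_continuousOn (hy.continuousOn (s := Icc a b))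
    refine Integrable.of_bound (hmeas y hy) (K * B + C) ?_
    refine (ae_restrict_iff' measurableSet_Icc).2 (Eventually.of_forall fun s hs => ?_)
    have h1 := (hF s).dist_le_mul (y s) 0
    rw [dist_eq_norm, dist_zero_right] at h1
    calc ‖F s (y s)‖ = ‖(F s (y s) - F s 0) + F s 0‖ := by rw [sub_add_cancel]
      _ ≤ ‖F s (y s) - F s 0‖ + ‖F s 0‖ := norm_add_le _ _
      _ ≤ K * B + C := add_le_add (h1.trans (by gcongr; exact hB s hs)) (hC s hs)
  have hint' : ∀ y : ℝ → E, Continuous y → ∀ t ∈ Icc a b,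
      IntervalIntegrable (fun s => F s (y s)) volume a t := fun y hy t ht =>
    ((hint y hy).mono_set (by rw [uIcc_of_le ht.1]; exact Icc_subset_Icc_right ht.2)
      ).intervalIntegrable
  let T : C(Icc a b, E) → C(Icc a b, E) := fun v =>
    ⟨fun t => Real.exp (-(L * ((t : ℝ) - a))) • (x₀ + ∫ s in a..t, F s (ext v s)), by
      have h1 : ContinuousOn (fun t => ∫ s in a..t, F s (ext v s)) (Icc a b) := by
        have := intervalIntegral.continuousOn_primitive_interval (μ := volume) (a := a) (b := b)
          (f := fun s => F s (ext v s)) (by rw [uIcc_of_le hab]; exact hint _ (hext v))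
        rwa [uIcc_of_le hab] at this
      have h2 := h1.domRestrict
      have h3 : Continuous fun t : Icc a b => Real.exp (-(L * ((t : ℝ) - a))) := by fun_prop
      exact h3.smul (continuous_const.add h2)⟩
  have hTapp : ∀ v t, T v t =
      Real.exp (-(L * ((t : ℝ) - a))) • (x₀ + ∫ s in a..t, F s (ext v s)) := fun _ _ => rfl
  have hT : ContractingWith (1 / 2) T := by
    refine ⟨by rw [one_div]; exact NNReal.inv_lt_one_iff (by norm_num) |>.2 (by norm_num), ?_⟩
    refine LipschitzWith.of_dist_le_mul fun v w => ?_
    rw [ContinuousMap.dist_le (by positivity)]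
    intro t
    have hexp : ∫ s in a..(t : ℝ), (K * dist v w) * Real.exp (L * (s - a)) =
        (K * dist v w) * ((Real.exp (L * (t - a)) - 1) / L) := by
      rw [intervalIntegral.integral_const_mul]
      congr 1
      have hd : ∀ s ∈ uIcc a (t : ℝ), HasDerivAt (fun s => Real.exp (L * (s - a)) / L)
          (Real.exp (L * (s - a))) s := by
        intro s _
        have := (((hasDerivAt_id s).sub_const a).const_mul L).exp.div_const L
        simpa [hLpos.ne'] using this
      rw [intervalIntegral.integral_eq_sub_of_hasDerivAt hd
        (Continuous.intervalIntegrable (by fun_prop) _ _)]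
      simp
      ring
    have hle : ‖∫ s in a..(t : ℝ), (F s (ext v s) - F s (ext w s))‖ ≤
        ∫ s in a..(t : ℝ), (K * dist v w) * Real.exp (L * (s - a)) := by
      refine intervalIntegral.norm_integral_le_of_norm_le t.2.1
        (Eventually.of_forall fun s _ => ?_) (Continuous.intervalIntegrable (by fun_prop) _ _)
      rw [← dist_eq_norm]
      refine ((hF s).dist_le_mul _ _).trans ?_
      have : dist (ext v s) (ext w s) ≤ Real.exp (L * (s - a)) * dist v w := by
        rw [dist_eq_norm, ← smul_sub, norm_smul, Real.norm_of_nonneg (Real.exp_nonneg _),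
          ← dist_eq_norm]
        gcongr
        exact ContinuousMap.dist_apply_le_dist _
      calc (K : ℝ) * dist (ext v s) (ext w s) ≤ K * (Real.exp (L * (s - a)) * dist v w) := by gcongr
        _ = _ := by ring
    have hsub : dist (T v t) (T w t) = Real.exp (-(L * ((t : ℝ) - a))) *
        ‖∫ s in a..(t : ℝ), (F s (ext v s) - F s (ext w s))‖ := by
      rw [intervalIntegral.integral_sub (hint' _ (hext v) t t.2) (hint' _ (hext w) t t.2),
        dist_eq_norm, hTapp, hTapp, ← smul_sub, norm_smul, Real.norm_of_nonneg (Real.exp_nonneg _), add_sub_add_left_eq_sub]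
    rw [hsub]
    refine (mul_le_mul_of_nonneg_left (hle.trans_eq hexp) (Real.exp_nonneg _)).trans ?_
    have h1 : Real.exp (-(L * ((t : ℝ) - a))) * Real.exp (L * ((t : ℝ) - a)) = 1 := by
      rw [← Real.exp_add]; simp
    have h2 : 0 ≤ Real.exp (-(L * ((t : ℝ) - a))) := Real.exp_nonneg _
    have h3 : Real.exp (-(L * ((t : ℝ) - a))) * (K * dist v w *
        ((Real.exp (L * (t - a)) - 1) / L)) =
        (K / L) * dist v w * (1 - Real.exp (-(L * ((t : ℝ) - a)))) := by
      calc _ = (K / L) * dist v w * (Real.exp (-(L * ((t : ℝ) - a))) * Real.exp (L * ((t : ℝ) - a))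
            - Real.exp (-(L * ((t : ℝ) - a)))) := by ring
        _ = _ := by rw [h1]
    rw [h3]
    have h4 : (K : ℝ) / L ≤ 1 / 2 := by
      rw [div_le_div_iff₀ hLpos (by norm_num)]; linarith
    have h5 : (0 : ℝ) ≤ K / L := by positivity
    have h6 : (0 : ℝ) ≤ dist v w := dist_nonneg
    calc (K : ℝ) / L * dist v w * (1 - Real.exp (-(L * ((t : ℝ) - a))))
        ≤ (K : ℝ) / L * dist v w * 1 := by gcongr; linarith
      _ ≤ 1 / 2 * dist v w := by rw [mul_one]; gcongr
      _ = _ := by simp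
  have : Nonempty C(Icc a b, E) := ⟨0⟩
  obtain ⟨v, hv⟩ : ∃ v, T v = v := ⟨_, hT.fixedPoint_isFixedPt⟩
  refine ⟨ext v, hext v, fun t ht => ?_⟩
  have hvt : T v ⟨t, ht⟩ = v ⟨t, ht⟩ := by rw [hv]
  change Real.exp (L * (t - a)) • v (projIcc a b hab t) = _
  rw [projIcc_of_mem hab ht, ← hvt, hTapp, smul_smul, ← Real.exp_add]
  simp

/-! ### Comparison functions -/

namespace ClassK

variable {α : ℝ → ℝ}

theorem monotoneOn (h : ClassK α) : MonotoneOn α (Ici 0) := h.strictMonoOn.monotoneOn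

theorem nonneg (h : ClassK α) {r : ℝ} (hr : 0 ≤ r) : 0 ≤ α r := by
  rw [← h.map_zero]
  exact h.monotoneOn (mem_Ici.2 le_rfl) hr hr

theorem mapsTo (h : ClassK α) : MapsTo α (Ici 0) (Ici 0) := fun _ hr => h.nonneg hr

theorem comp {β : ℝ → ℝ} (hβ : ClassK β) (hα : ClassK α) : ClassK fun r => β (α r) where
  continuousOn := hβ.continuousOn.comp hα.continuousOn hα.mapsTo
  strictMonoOn := hβ.strictMonoOn.comp hα.strictMonoOn hα.mapsTo
  map_zero := by rw [hα.map_zero, hβ.map_zero]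

theorem const_mul (h : ClassK α) {k : ℝ} (hk : 0 < k) : ClassK fun r => k * α r where
  continuousOn := continuousOn_const.mul h.continuousOn
  strictMonoOn := fun _ hr _ ht hrt => mul_lt_mul_of_pos_left (h.strictMonoOn hr ht hrt) hk
  map_zero := by rw [h.map_zero, mul_zero]

end ClassK

namespace ClassKInf

variable {α β : ℝ → ℝ}

theorem comp (hβ : ClassKInf β) (hα : ClassKInf α) : ClassKInf fun r => β (α r) where
  toClassK := hβ.toClassK.comp hα.toClassK
  unbounded := hβ.unbounded.comp hα.unbounded

theorem const_mul (h : ClassKInf α) {k : ℝ} (hk : 0 < k) : ClassKInf fun r => k * α r where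
  toClassK := h.toClassK.const_mul hk
  unbounded := h.unbounded.const_mul_atTop hk

theorem max (hα : ClassKInf α) (hβ : ClassKInf β) : ClassKInf fun r => max (α r) (β r) where
  continuousOn := hα.continuousOn.sup hβ.continuousOn
  strictMonoOn := fun _ hr _ ht hrt =>
    max_lt_max (hα.strictMonoOn hr ht hrt) (hβ.strictMonoOn hr ht hrt)
  map_zero := by rw [hα.map_zero, hβ.map_zero, max_self]
  unbounded := tendsto_atTop_mono (fun _ => le_max_left _ _) hα.unbounded

end ClassKInf

/-! ### Decrease of a Lyapunov function along flows -/

namespace IsInput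

variable {U : Type*} [NormedAddCommGroup U] {t₀ : ℝ} {u : ℝ → U}

theorem bddAbove (hu : IsInput t₀ u) {t : ℝ} (ht : t₀ ≤ t) :
    BddAbove ((fun s => ‖u s‖) '' Icc t₀ t) := by
  obtain ⟨C, hC⟩ := hu.locallyBounded t ht
  exact ⟨C, by rintro _ ⟨s, hs, rfl⟩; exact hC s hs⟩

theorem norm_le_supNorm (hu : IsInput t₀ u) {s t : ℝ} (hs : s ∈ Icc t₀ t) :
    ‖u s‖ ≤ supNorm u t₀ t :=
  le_csSup (hu.bddAbove (hs.1.trans hs.2)) (mem_image_of_mem _ hs)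

theorem supNorm_nonneg (hu : IsInput t₀ u) {t : ℝ} (ht : t₀ ≤ t) : 0 ≤ supNorm u t₀ t :=
  (norm_nonneg _).trans (hu.norm_le_supNorm (left_mem_Icc.2 ht))

end IsInput

namespace ImpulsiveSystem

variable {E U : Type*} [NormedAddCommGroup E] [InnerProductSpace ℝ E] [FiniteDimensional ℝ E]
  [NormedAddCommGroup U] {p : ℕ} {t₀ : ℝ} {u : ℝ → U}

theorem continuous_f {E U : Type*} [NormedAddCommGroup E] [NormedAddCommGroup U] {p : ℕ}
    (Sys : ImpulsiveSystem E U p) : Continuous fun q : E × U => Sys.f q.1 q.2 :=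
  Sys.f_locallyLipschitz.continuous

theorem exists_norm_f_le [ProperSpace U] (Sys : ImpulsiveSystem E U p) (hu : IsInput t₀ u)
    {y : ℝ → E} {a b : ℝ} (ha : t₀ ≤ a) (hab : a ≤ b) (hy : ContinuousOn y (Icc a b)) :
    ∃ C : ℝ≥0, ∀ t ∈ Icc a b, ‖Sys.f (y t) (u t)‖ ≤ C := by
  obtain ⟨R, hR⟩ := isCompact_Icc.exists_bound_of_continuousOn hy
  obtain ⟨S, hS⟩ := hu.locallyBounded b (ha.trans hab)
  obtain ⟨C, hC⟩ := ((isCompact_closedBall (0 : E) R).prod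
    (isCompact_closedBall (0 : U) S)).exists_bound_of_continuousOn Sys.continuous_f.continuousOn
  refine ⟨C.toNNReal, fun t ht => le_trans (hC (y t, u t) ⟨?_, ?_⟩) (Real.le_coe_toNNReal C)⟩
  · simpa using hR t ht
  · simpa using hS t ⟨ha.trans ht.1, ht.2⟩

theorem integrableOn_f [ProperSpace U] (Sys : ImpulsiveSystem E U p) (hu : IsInput t₀ u)
    {y : ℝ → E} {a b : ℝ} (ha : t₀ ≤ a) (hab : a ≤ b) (hy : ContinuousOn y (Icc a b)) :
    IntegrableOn (fun t => Sys.f (y t) (u t)) (Icc a b) := by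
  obtain ⟨C, hC⟩ := Sys.exists_norm_f_le hu ha hab hy
  have hm : AEStronglyMeasurable u (volume.restrict (Icc a b)) :=
    hu.measurable.mono_measure (Measure.restrict_mono (fun t ht => ha.trans ht.1) le_rfl)
  refine Integrable.of_bound (Sys.continuous_f.comp_aestronglyMeasurable
    ((hy.aestronglyMeasurable measurableSet_Icc).prodMk hm)) C ?_
  exact (ae_restrict_iff' measurableSet_Icc).2 (Eventually.of_forall hC)

theorem intervalIntegrable_f [ProperSpace U] (Sys : ImpulsiveSystem E U p) (hu : IsInput t₀ u)
    {y : ℝ → E} {a b s t : ℝ} (ha : t₀ ≤ a) (hab : a ≤ b) (hy : ContinuousOn y (Icc a b))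
    (hs : s ∈ Icc a b) (ht : t ∈ Icc a b) :
    IntervalIntegrable (fun t => Sys.f (y t) (u t)) volume s t :=
  ((Sys.integrableOn_f hu ha hab hy).mono_set (uIcc_subset_Icc hs ht)).intervalIntegrable

/-- Right-continuity of `u` makes the integrand right-continuous, so the right derivative exists at
every time and not just almost everywhere. The fencing argument cannot tolerate an exceptional null
set. -/
theorem hasDerivWithinAt_of_integral_eq [ProperSpace U] (Sys : ImpulsiveSystem E U p)
    (hu : IsInput t₀ u) {y : ℝ → E} {a b : ℝ} (ha : t₀ ≤ a) (hy : ContinuousOn y (Icc a b))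
    (heq : ∀ t ∈ Icc a b, y t = y a + ∫ s in a..t, Sys.f (y s) (u s)) {t : ℝ}
    (ht : t ∈ Ico a b) : HasDerivWithinAt y (Sys.f (y t) (u t)) (Ici t) t := by
  have hab : a ≤ b := ht.1.trans ht.2.le
  have hmem : Icc a b ∈ 𝓝[≥] t := Icc_mem_nhdsGE_of_mem ht
  have hcont : ContinuousWithinAt (fun s => Sys.f (y s) (u s)) (Ici t) t := by
    have h1 : ContinuousWithinAt y (Ici t) t :=
      (hy t (Ico_subset_Icc_self ht)).mono_of_mem_nhdsWithin hmem
    exact Sys.continuous_f.continuousAt.comp_continuousWithinAt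
      (h1.prodMk (hu.rightContinuous t (ha.trans ht.1)))
  have hd : HasDerivWithinAt (fun r => y a + ∫ s in a..r, Sys.f (y s) (u s))
      (Sys.f (y t) (u t)) (Ici t) t := by
    refine HasDerivWithinAt.const_add _ (intervalIntegral.integral_hasDerivWithinAt_right
      (t := Ioi t) ?_ ?_ (hcont.mono Ioi_subset_Ici_self))
    · exact Sys.intervalIntegrable_f hu ha hab hy (left_mem_Icc.2 hab) (Ico_subset_Icc_self ht)
    · exact ⟨Icc a b, nhdsWithin_mono _ Ioi_subset_Ici_self hmem,
        (Sys.integrableOn_f hu ha hab hy).aestronglyMeasurable⟩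
  refine hd.congr_of_eventuallyEq ?_ (heq t (Ico_subset_Icc_self ht))
  filter_upwards [hmem] with s hs using heq s hs

end ImpulsiveSystem

namespace IsCandidateExpISSLyapunov

variable {E U : Type*} [NormedAddCommGroup E] [InnerProductSpace ℝ E] [FiniteDimensional ℝ E]
  [MeasurableSpace E] [BorelSpace E] [NormedAddCommGroup U] {p : ℕ} {t₀ : ℝ} {u : ℝ → U}
  {Sys : ImpulsiveSystem E U p} {V : E → ℝ} {γ : ℝ → ℝ} {c : ℝ} {d : Fin p → ℝ}

theorem nonneg (hV : IsCandidateExpISSLyapunov Sys V γ c d) (x : E) : 0 ≤ V x := by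
  rcases eq_or_ne x 0 with rfl | hx
  · rw [hV.map_zero]
  · exact (hV.pos x hx).le

/-- The decrease condition, required only almost everywhere on the state space, implies a decrease
along every segment in the direction of the vector field. -/
theorem exists_add_smul_le (hV : IsCandidateExpISSLyapunov Sys V γ c d) {x : E} {w : U}
    (hx : γ ‖w‖ < V x) {δ : ℝ} (hδ : 0 < δ) :
    ∃ (K : ℝ≥0) (r : ℝ), 0 < r ∧ LipschitzOnWith K V (Metric.ball x r) ∧
      ∀ h, 0 ≤ h → h * ‖Sys.f x w‖ < r →
        V (x + h • Sys.f x w) ≤ V x + h * (-c * V x + δ) := by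
  have hVx : 0 < V x := (hV.gain.nonneg (norm_nonneg w)).trans_lt hx
  have hx0 : x ∈ ({0}ᶜ : Set E) := by
    rintro rfl
    exact hVx.ne' hV.map_zero
  obtain ⟨K, t, ht, hK⟩ := hV.locallyLipschitzOn hx0
  rw [isOpen_compl_singleton.nhdsWithin_eq hx0] at ht
  have hf : Continuous fun y => Sys.f y w := Sys.continuous_f.comp (continuous_id.prodMk continuous_const)
  have h1 : ∀ᶠ y in 𝓝 x, γ ‖w‖ < V y := hV.continuous.continuousAt.eventually (lt_mem_nhds hx)
  -- The hypothesis at `y` concerns the direction `f y w`, but the segment has the fixed direction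
  -- `f x w`; the Lipschitz constant of `V` times the difference is absorbed by `δ`.
  have h2 : ∀ᶠ y in 𝓝 x, -c * V y + K * ‖Sys.f x w - Sys.f y w‖ < -c * V x + δ := by
    have hc : Continuous fun y => -c * V y + K * ‖Sys.f x w - Sys.f y w‖ := by
      have := hV.continuous
      fun_prop
    refine hc.continuousAt.eventually (gt_mem_nhds ?_)
    simpa using hδ
  obtain ⟨r, hr, hball⟩ := Metric.mem_nhds_iff.1 (inter_mem ht (h1.and h2))
  have hKr : LipschitzOnWith K V (Metric.ball x r) := hK.mono fun y hy => (hball hy).1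
  refine ⟨K, r, hr, hKr, fun h hh hhr => ?_⟩
  -- `V` is Lipschitz only on the ball; a global extension has the same derivatives inside it.
  obtain ⟨W, hW, hVW⟩ := hKr.extend_real
  have hWV : ∀ y ∈ Metric.ball x r, fderiv ℝ W y = fderiv ℝ V y := fun y hy =>
    Filter.EventuallyEq.fderiv_eq (by
      filter_upwards [Metric.isOpen_ball.mem_nhds hy] with z hz using (hVW hz).symm)
  have hmem : x + h • Sys.f x w ∈ Metric.ball x r := by
    rw [Metric.mem_ball, dist_eq_norm, add_sub_cancel_left, norm_smul, Real.norm_of_nonneg hh]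
    exact hhr
  have key := hW.add_smul_le_of_ae_fderiv_le (x := x) (v := Sys.f x w) (r := r)
    (m := -c * V x + δ) ?_ hh hhr
  · rwa [← hVW hmem, ← hVW (Metric.mem_ball_self hr)] at key
  filter_upwards [hV.flow] with y hy hyr
  obtain ⟨_, hy1, hy2⟩ := hball hyr
  have hd := hy w (le_of_lt hy1)
  have hn : ‖fderiv ℝ V y‖ ≤ K := by
    rw [← hWV y hyr]
    exact norm_fderiv_le_of_lipschitz ℝ hW
  have hsplit : fderiv ℝ V y (Sys.f x w) =
      fderiv ℝ V y (Sys.f y w) + fderiv ℝ V y (Sys.f x w - Sys.f y w) := by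
    rw [← map_add, add_sub_cancel]
  have hle : fderiv ℝ V y (Sys.f x w - Sys.f y w) ≤ K * ‖Sys.f x w - Sys.f y w‖ :=
    (Real.le_norm_self _).trans ((fderiv ℝ V y).le_of_opNorm_le hn _)
  rw [hWV y hyr, hsplit]
  have hy2' : -c * V y + K * ‖Sys.f x w - Sys.f y w‖ < -c * V x + δ := hy2
  linarith

/-- To first order the curve is the segment in direction `f (y t) w`. One half of `δ` pays for the
decrease along the segment, the other for the `o(z - t)` deviation, measured through the local
Lipschitz constant of `V`. -/
theorem eventually_comp_le (hV : IsCandidateExpISSLyapunov Sys V γ c d) {y : ℝ → E} {w : U}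
    {t : ℝ} (hy : HasDerivWithinAt y (Sys.f (y t) w) (Ici t) t) (hx : γ ‖w‖ < V (y t)) {δ : ℝ}
    (hδ : 0 < δ) : ∀ᶠ z in 𝓝[>] t, V (y z) ≤ V (y t) + (z - t) * (-c * V (y t) + δ) := by
  obtain ⟨K, r, hr, hK, hle⟩ := hV.exists_add_smul_le hx (half_pos hδ)
  set v := Sys.f (y t) w
  have hη : 0 < δ / 2 / (K + 1) := by positivity
  have h1 := (hasDerivWithinAt_iff_isLittleO.1 hy).def hη
  have h2 : ∀ᶠ z in 𝓝[≥] t, y z ∈ Metric.ball (y t) r :=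
    hy.continuousWithinAt.eventually (Metric.ball_mem_nhds _ hr)
  have h3 : ∀ᶠ z in 𝓝[>] t, (z - t) * ‖v‖ < r := by
    have hc : Continuous fun z : ℝ => (z - t) * ‖v‖ := by fun_prop
    exact nhdsWithin_le_nhds (hc.continuousAt.eventually (gt_mem_nhds (by simpa using hr)))
  have hmono : 𝓝[>] t ≤ 𝓝[≥] t := nhdsWithin_mono _ Ioi_subset_Ici_self
  filter_upwards [hmono h1, hmono h2, h3, self_mem_nhdsWithin] with z hz1 hz2 hz3 hzt
  have hzt : 0 ≤ z - t := sub_nonneg.2 (le_of_lt hzt)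
  have hmem : y t + (z - t) • v ∈ Metric.ball (y t) r := by
    rw [Metric.mem_ball, dist_eq_norm, add_sub_cancel_left, norm_smul, Real.norm_of_nonneg hzt]
    exact hz3
  have hlip := hK.dist_le_mul _ hz2 _ hmem
  rw [dist_eq_norm, dist_eq_norm, ← sub_sub] at hlip
  rw [Real.norm_of_nonneg hzt] at hz1
  have h4 : (K : ℝ) * ‖y z - y t - (z - t) • v‖ ≤ δ / 2 * (z - t) := by
    calc (K : ℝ) * ‖y z - y t - (z - t) • v‖
        ≤ (K + 1) * (δ / 2 / (K + 1) * (z - t)) := by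
          gcongr
          linarith
      _ = δ / 2 * (z - t) := by field_simp
  have h5 := (le_abs_self _).trans (hlip.trans h4)
  have h6 := hle _ hzt hz3
  linarith

/-- Bound of the Lyapunov function along a flow, as long as it is not dominated by the input. -/
theorem flow_le [ProperSpace U] (hV : IsCandidateExpISSLyapunov Sys V γ c d) (hu : IsInput t₀ u)
    {y : ℝ → E} {a b G k : ℝ} (ha : t₀ ≤ a) (hy : ContinuousOn y (Icc a b))
    (heq : ∀ t ∈ Icc a b, y t = y a + ∫ s in a..t, Sys.f (y s) (u s))
    (hG : ∀ t ∈ Icc a b, γ ‖u t‖ ≤ G) (hya : V (y a) ≤ k)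
    (hGk : ∀ t ∈ Icc a b, G ≤ k * Real.exp (-c * (t - a))) :
    ∀ t ∈ Icc a b, V (y t) ≤ k * Real.exp (-c * (t - a)) := by
  -- The `η`-margin does two things at a point of contact: it puts `V (y t)` strictly above `γ ‖u
  -- t‖`, so the decrease applies, and it gives the barrier an extra slope `η exp (-c (t - a))`,
  -- whose two halves cover the two first-order errors.
  have main : ∀ η, 0 < η → ∀ t ∈ Icc a b,
      V (y t) ≤ (k + η * (1 + (t - a))) * Real.exp (-c * (t - a)) := by
    intro η hη
    have hd : ∀ t, HasDerivAt (fun t => (k + η * (1 + (t - a))) * Real.exp (-c * (t - a)))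
        (-c * ((k + η * (1 + (t - a))) * Real.exp (-c * (t - a))) +
          η * Real.exp (-c * (t - a))) t := by
      intro t
      have h1 : HasDerivAt (fun t => k + η * (1 + (t - a))) η t := by
        simpa using ((((hasDerivAt_id t).sub_const a).const_add 1).const_mul η).const_add k
      have h2 : HasDerivAt (fun t => Real.exp (-c * (t - a)))
          (Real.exp (-c * (t - a)) * -c) t := by
        simpa using (((hasDerivAt_id t).sub_const a).const_mul (-c)).exp
      exact (h1.mul h2).congr_deriv (by ring)
    refine le_of_frequently_le_of_eq (hV.continuous.comp_continuousOn hy) ?_ ?_ ?_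
    · exact fun t _ => (hd t).continuousAt.continuousWithinAt
    · simp
      linarith
    · intro t ht hteq
      have ht' := Ico_subset_Icc_self ht
      have he := Real.exp_pos (-c * (t - a))
      have hpos : 0 < η * (1 + (t - a)) := by
        have := ht.1
        have : 0 < 1 + (t - a) := by linarith
        positivity
      have hlt : γ ‖u t‖ < V (y t) := by
        rw [hteq]
        refine ((hG t ht').trans (hGk t ht')).trans_lt ?_
        gcongr
        linarith
      have h1 := hV.eventually_comp_le
        (Sys.hasDerivWithinAt_of_integral_eq hu ha hy heq ht) hlt
        (δ := η * Real.exp (-c * (t - a)) / 2) (by positivity)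
      have h2 := (hasDerivWithinAt_iff_isLittleO.1 ((hd t).hasDerivWithinAt (s := Ioi t))).def
        (c := η * Real.exp (-c * (t - a)) / 2) (by positivity)
      refine Eventually.frequently ?_
      filter_upwards [h1, h2, self_mem_nhdsWithin] with z hz1 hz2 hzt
      have hzt : 0 ≤ z - t := sub_nonneg.2 (le_of_lt hzt)
      rw [Real.norm_of_nonneg hzt] at hz2
      have hz3 := (abs_le.1 hz2).1
      rw [hteq] at hz1
      rw [smul_eq_mul] at hz3
      linarith
  intro t ht
  refine le_of_forall_pos_le_add fun ε hε => ?_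
  have hpos : 0 < (1 + (t - a)) * Real.exp (-c * (t - a)) := by
    have := ht.1
    have : 0 < 1 + (t - a) := by linarith
    positivity
  refine (main (ε / ((1 + (t - a)) * Real.exp (-c * (t - a)))) (by positivity) t ht).trans_eq ?_
  have h1 : (1 + (t - a)) ≠ 0 := by
    have := ht.1
    linarith
  field_simp

/-- On an interval without impulses, solutions with arbitrary initial state exist. -/
theorem exists_flow [ProperSpace U] (hV : IsCandidateExpISSLyapunov Sys V γ c d)
    (hu : IsInput t₀ u) {a b : ℝ} (ha : t₀ ≤ a) (hab : a ≤ b) (xa : E) :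
    ∃ y : ℝ → E, ContinuousOn y (Icc a b) ∧ y a = xa ∧
      ∀ t ∈ Icc a b, y t = y a + ∫ s in a..t, Sys.f (y s) (u s) := by
  obtain ⟨S, hS⟩ := hu.locallyBounded b (ha.trans hab)
  have hS' : ∀ t ∈ Icc a b, ‖u t‖ ≤ S := fun t ht => hS t ⟨ha.trans ht.1, ht.2⟩
  have hS0 : 0 ≤ S := (norm_nonneg _).trans (hS' a (left_mem_Icc.2 hab))
  set G := γ S
  have hG0 : 0 ≤ G := hV.gain.nonneg hS0
  have hexp : ∀ t ∈ Icc a b, -(|c| * (b - a)) ≤ -c * (t - a) ∧ -c * (t - a) ≤ |c| * (b - a) := by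
    intro t ht
    rw [← abs_le, abs_mul, abs_neg, abs_of_nonneg (sub_nonneg.2 ht.1)]
    gcongr
    exact ht.2
  -- With this `k` the input level `G` stays below `k exp (-c (t - a))` on all of `[a, b]`, as
  -- `flow_le` requires; `M` dominates that barrier from above, so `R` is an a priori bound on the
  -- state.
  set k := max (V xa) (G * Real.exp (|c| * (b - a)))
  have hk0 : 0 ≤ k := (hV.nonneg xa).trans (le_max_left _ _)
  set M := k * Real.exp (|c| * (b - a))
  have hkM : k ≤ M := by
    refine le_mul_of_one_le_right hk0 (Real.one_le_exp ?_)
    have := sub_nonneg.2 hab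
    positivity
  obtain ⟨R, hR⟩ : ∃ R, ∀ x, V x ≤ M → ‖x‖ ≤ R := by
    have h := hV.radiallyUnbounded.eventually (eventually_gt_atTop M)
    obtain ⟨s, hs, hsub⟩ := mem_cocompact.1 h
    obtain ⟨R, hR⟩ := hs.isBounded.exists_norm_le
    refine ⟨R, fun x hx => hR x ?_⟩
    by_contra hxs
    exact absurd hx (not_le.2 (hsub hxs))
  have hcomp : IsCompact (Metric.closedBall (0 : E) (R + 1) ×ˢ Metric.closedBall (0 : U) S) :=
    (isCompact_closedBall _ _).prod (isCompact_closedBall _ _)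
  obtain ⟨L, hL⟩ := LocallyLipschitzOn.exists_lipschitzOnWith_of_compact hcomp
    (Sys.f_locallyLipschitz.locallyLipschitzOn)
  -- Solve with a globally Lipschitz extension of `f` from the compact set, then show that the
  -- solution never leaves the region where the two agree.
  obtain ⟨F, hF, hfF⟩ := hL.extend_finite_dimension
  set L' := lipschitzExtensionConstant E * L
  have hm : AEStronglyMeasurable u (volume.restrict (Icc a b)) :=
    hu.measurable.mono_measure (Measure.restrict_mono (fun t ht => ha.trans ht.1) le_rfl)
  obtain ⟨y, hyc, hy⟩ := exists_integral_solution (F := fun t x => F (x, u t)) (K := L')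
    (C := ‖F 0‖ + L' * S) hab
    (fun t => by simpa [Function.comp_def] using hF.comp (LipschitzWith.prodMk_right (u t)))
    (fun z hz => hF.continuous.comp_aestronglyMeasurable
      (hz.aestronglyMeasurable.prodMk hm))
    (fun t ht => by
      have h1 := hF.dist_le_mul (0, u t) 0
      rw [dist_eq_norm, dist_zero_right] at h1
      have h2 : ‖((0 : E), u t)‖ ≤ S := by
        rw [Prod.norm_def]
        simpa using hS' t ht
      calc ‖F (0, u t)‖ = ‖F 0 + (F (0, u t) - F 0)‖ := by rw [add_sub_cancel]
        _ ≤ ‖F 0‖ + ‖F (0, u t) - F 0‖ := norm_add_le _ _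
        _ ≤ ‖F 0‖ + L' * S := by gcongr; exact h1.trans (by gcongr)) xa
  have hya : y a = xa := by simpa using hy a (left_mem_Icc.2 hab)
  have hiden : ∀ t ∈ Icc a b, (∀ s ∈ Icc a t, ‖y s‖ ≤ R + 1) →
      y t = y a + ∫ s in a..t, Sys.f (y s) (u s) := by
    intro t ht hs
    rw [hy t ht, hya]
    congr 1
    refine intervalIntegral.integral_congr fun s hs' => ?_
    rw [uIcc_of_le ht.1] at hs'
    refine (hfF (x := (y s, u s)) ⟨?_, ?_⟩).symm
    · simpa using hs s hs'
    · simpa using hS' s ⟨hs'.1, hs'.2.trans ht.2⟩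
  -- At the first time `τ` with norm `R + 1`, the curve has solved the original equation throughout
  -- `[a, τ]`. Hence `V (y τ) ≤ M`, and the norm is at most `R`, a contradiction.
  have hbound : ∀ t ∈ Icc a b, ‖y t‖ < R + 1 := by
    by_contra! hcon
    obtain ⟨t', ht', hRt'⟩ := hcon
    have hcpt : IsCompact (Icc a b ∩ {t | R + 1 ≤ ‖y t‖}) :=
      isCompact_Icc.inter_right (isClosed_le continuous_const hyc.norm)
    obtain ⟨τ, ⟨hτ, hRτ⟩, hmin⟩ := hcpt.exists_isLeast ⟨t', ht', hRt'⟩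
    have haR : ‖y a‖ < R + 1 := by
      rw [hya]
      linarith [hR xa ((le_max_left _ _).trans hkM)]
    have haτ : a < τ := by
      refine lt_of_le_of_ne hτ.1 ?_
      rintro rfl
      exact absurd hRτ (not_le.2 haR)
    have hle : ∀ s ∈ Icc a τ, ‖y s‖ ≤ R + 1 := by
      rw [← closure_Ico haτ.ne]
      refine closure_minimal (fun s hs => ?_) (isClosed_le hyc.norm continuous_const)
      by_contra hs'
      have hs'' : ¬ ‖y s‖ ≤ R + 1 := hs'
      have hmem : s ∈ {t | R + 1 ≤ ‖y t‖} := (not_le.1 hs'').le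
      exact absurd hs.2 (not_lt.2 (hmin ⟨⟨hs.1, hs.2.le.trans hτ.2⟩, hmem⟩))
    have hsub : Icc a τ ⊆ Icc a b := Icc_subset_Icc_right hτ.2
    have hfl := hV.flow_le hu (y := y) (b := τ) (G := G) (k := k) ha hyc.continuousOn
      (fun t ht => hiden t (hsub ht) fun s hs => hle s ⟨hs.1, hs.2.trans ht.2⟩)
      (fun t ht => hV.gain.monotoneOn (norm_nonneg _) hS0 (hS' t (hsub ht)))
      (by rw [hya]; exact le_max_left _ _)
      (fun t ht => by
        calc G = G * Real.exp (|c| * (b - a)) * Real.exp (-(|c| * (b - a))) := by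
              rw [mul_assoc, ← Real.exp_add]; simp
          _ ≤ k * Real.exp (-c * (t - a)) := by
              gcongr
              · exact le_max_right _ _
              · exact (hexp t (hsub ht)).1) τ (right_mem_Icc.2 haτ.le)
    have hVM : V (y τ) ≤ M := hfl.trans
      (mul_le_mul_of_nonneg_left (Real.exp_le_exp.2 (hexp τ hτ).2) hk0)
    have := hR _ hVM
    have hRτ' : R + 1 ≤ ‖y τ‖ := hRτ
    linarith
  exact ⟨y, hyc.continuousOn, hya, fun t ht =>
    hiden t ht fun s hs => (hbound s ⟨hs.1, hs.2.trans ht.2⟩).le⟩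

end IsCandidateExpISSLyapunov

/-! ### Existence of solutions -/

namespace IsImpulseTimes

variable {p : ℕ} {t₀ : ℝ} {T : Fin p → Set ℝ}

theorem finite_iUnion_inter_Ioc (hT : IsImpulseTimes t₀ T) (s t : ℝ) :
    ((⋃ i, T i) ∩ Ioc s t).Finite := by
  rw [iUnion_inter]
  exact Set.finite_iUnion fun i => hT.finite i s t

theorem countable_iUnion (hT : IsImpulseTimes t₀ T) : (⋃ i, T i).Countable := by
  have : (⋃ i, T i) ⊆ ⋃ n : ℕ, (⋃ i, T i) ∩ Ioc (-n : ℝ) n := by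
    intro t ht
    obtain ⟨n, hn⟩ := exists_nat_gt |t|
    exact mem_iUnion.2 ⟨n, ht, (abs_lt.1 hn).1, (abs_lt.1 hn).2.le⟩
  exact (Set.countable_iUnion fun n : ℕ => (hT.finite_iUnion_inter_Ioc _ _).countable).mono this

end IsImpulseTimes

/-! ### Solutions in integrated form and their concatenation. -/

namespace ImpulsiveSystem

section

variable {E U : Type*} [NormedAddCommGroup E] [NormedSpace ℝ E] [NormedAddCommGroup U] {p : ℕ}

/-- Solutions on `[t₀, b]`, with the differential equation in integrated form. -/
structure IsIntegralSolution (Sys : ImpulsiveSystem E U p) (t₀ : ℝ) (T : Fin p → Set ℝ)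
    (u : ℝ → U) (x₀ : E) (b : ℝ) (x : ℝ → E) : Prop where
  init : x t₀ = x₀
  integrable : IntervalIntegrable (fun t => Sys.f (x t) (u t)) volume t₀ b
  integral_eq : ∀ s t, t₀ ≤ s → s ≤ t → t ≤ b → Disjoint (⋃ i, T i) (Ioc s t) →
    x t = x s + ∫ r in s..t, Sys.f (x r) (u r)
  jump : ∀ i, ∀ t ∈ T i, t ≤ b → ∃ xl ul, Tendsto x (𝓝[<] t) (𝓝 xl) ∧
    Tendsto u (𝓝[<] t) (𝓝 ul) ∧ x t = Sys.g i xl ul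

variable {Sys : ImpulsiveSystem E U p} {t₀ : ℝ} {T : Fin p → Set ℝ} {u : ℝ → U} {x₀ : E}

theorem IsIntegralSolution.congr {b : ℝ} {x x' : ℝ → E}
    (h : Sys.IsIntegralSolution t₀ T u x₀ b x) (hb : t₀ ≤ b) (heq : EqOn x x' (Iic b)) :
    Sys.IsIntegralSolution t₀ T u x₀ b x' where
  init := by rw [← heq (mem_Iic.2 hb), h.init]
  integrable := h.integrable.congr fun t ht => by
    rw [uIoc_of_le hb] at ht
    simp only [heq (mem_Iic.2 ht.2)]
  integral_eq s t hs hst htb hd := by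
    rw [← heq (mem_Iic.2 htb), ← heq (mem_Iic.2 (hst.trans htb)), h.integral_eq s t hs hst htb hd]
    congr 1
    refine intervalIntegral.integral_congr fun r hr => ?_
    rw [uIcc_of_le hst] at hr
    simp only [heq (mem_Iic.2 (hr.2.trans htb))]
  jump i t ht htb := by
    obtain ⟨xl, ul, h1, h2, h3⟩ := h.jump i t ht htb
    refine ⟨xl, ul, h1.congr' ?_, h2, by rw [← heq (mem_Iic.2 htb), h3]⟩
    filter_upwards [self_mem_nhdsWithin] with s hs
    exact heq (mem_Iic.2 ((le_of_lt hs).trans htb))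

theorem IsIntegralSolution.continuousOn {a b b' : ℝ} {x : ℝ → E}
    (hx : Sys.IsIntegralSolution t₀ T u x₀ b' x) (ha : t₀ ≤ a) (hab : a ≤ b) (hb : b ≤ b')
    (hd : Disjoint (⋃ i, T i) (Ioc a b)) : ContinuousOn x (Icc a b) := by
  have hi : IntegrableOn (fun r => Sys.f (x r) (u r)) (uIcc a b) := by
    have h := hx.integrable.mono_set (c := a) (d := b) (by
      rw [uIcc_of_le hab, uIcc_of_le (ha.trans (hab.trans hb))]
      exact Icc_subset_Icc ha hb)
    rwa [uIcc_of_le hab, ← intervalIntegrable_iff_integrableOn_Icc_of_le hab]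
  have h1 := intervalIntegral.continuousOn_primitive_interval hi
  rw [uIcc_of_le hab] at h1
  refine (continuousOn_const (c := x a)).add h1 |>.congr fun t ht => ?_
  exact hx.integral_eq a t ha ht.1 (ht.2.trans hb) (hd.mono_right (Ioc_subset_Ioc_right ht.2))

end

section

variable {E U : Type*} [NormedAddCommGroup E] [InnerProductSpace ℝ E] [FiniteDimensional ℝ E]
  [NormedAddCommGroup U] [ProperSpace U] {p : ℕ} {Sys : ImpulsiveSystem E U p} {t₀ : ℝ}
  {T : Fin p → Set ℝ} {u : ℝ → U} {x₀ : E}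

/-- A solution can be continued by a flow up to and including the next impulse. -/
theorem IsIntegralSolution.exists_concat (hT : IsImpulseTimes t₀ T) (hu : IsInput t₀ u)
    {a b : ℝ} {x y : ℝ → E} (hx : Sys.IsIntegralSolution t₀ T u x₀ a x) (ha : t₀ ≤ a)
    (hab : a < b) (hD : Disjoint (⋃ i, T i) (Ioo a b)) (hyc : ContinuousOn y (Icc a b))
    (hya : y a = x a) (hy : ∀ t ∈ Icc a b, y t = y a + ∫ s in a..t, Sys.f (y s) (u s)) :
    ∃ x', Sys.IsIntegralSolution t₀ T u x₀ b x' ∧ EqOn x x' (Iic a) := by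
  -- The endpoint value is the flow value or its image under the jump map; disjointness of the
  -- impulse sets ensures that only one jump map is concerned.
  obtain ⟨xb, hxb, hxb'⟩ : ∃ xb, (∀ i, b ∈ T i → ∃ ul, Tendsto u (𝓝[<] b) (𝓝 ul) ∧
      xb = Sys.g i (y b) ul) ∧ (b ∉ ⋃ i, T i → xb = y b) := by
    by_cases hb : b ∈ ⋃ i, T i
    · obtain ⟨i, hi⟩ := mem_iUnion.1 hb
      obtain ⟨ul, hul⟩ := hu.leftLimit b (ha.trans_lt hab)
      refine ⟨Sys.g i (y b) ul, fun j hj => ⟨ul, hul, ?_⟩, fun h => absurd hb h⟩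
      have : i = j := by
        by_contra hij
        exact Set.disjoint_left.1 (hT.disjoint i j hij) hi hj
      rw [this]
    · exact ⟨y b, fun i hi => absurd (mem_iUnion.2 ⟨i, hi⟩) hb, fun _ => rfl⟩
  let x' : ℝ → E := fun t => if t ≤ a then x t else if t < b then y t else xb
  have hx1 : EqOn x x' (Iic a) := fun t ht => by simp only [x', if_pos (mem_Iic.1 ht)]
  have hx2 : ∀ t ∈ Ico a b, x' t = y t := by
    intro t ht
    rcases ht.1.eq_or_lt with rfl | h
    · rw [hya, hx1 (mem_Iic.2 le_rfl)]
    · simp only [x', if_neg (not_le.2 h), if_pos ht.2]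
  have hx3 : x' b = xb := by simp only [x', if_neg (not_le.2 hab), lt_irrefl, if_false]
  have hxa := hx.congr ha hx1
  -- To the right of `a` the new curve differs from `y` up to `b` only at `b` itself, which
  -- integrals do not see.
  have hae : ∀ s t, a ≤ s → s ≤ t → t ≤ b → ∀ᵐ r, r ∈ uIoc s t →
      Sys.f (y r) (u r) = Sys.f (x' r) (u r) := by
    intro s t has hst htb
    have : ∀ᵐ r : ℝ, r ≠ b := by simp [ae_iff, measure_singleton]
    filter_upwards [this] with r hr hrs
    rw [uIoc_of_le hst] at hrs
    rw [hx2 r ⟨has.trans hrs.1.le, lt_of_le_of_ne (hrs.2.trans htb) hr⟩]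
  have hyint : ∀ s t, s ∈ Icc a b → t ∈ Icc a b →
      IntervalIntegrable (fun r => Sys.f (y r) (u r)) volume s t := fun s t =>
    Sys.intervalIntegrable_f hu ha hab.le hyc
  have hint : ∀ s t, a ≤ s → s ≤ t → t ≤ b →
      IntervalIntegrable (fun r => Sys.f (x' r) (u r)) volume s t := fun s t has hst htb =>
    (hyint s t ⟨has, hst.trans htb⟩ ⟨has.trans hst, htb⟩).congr_ae
      ((ae_restrict_iff' measurableSet_uIoc).2 (hae s t has hst htb))
  have key : ∀ s t, a ≤ s → s ≤ t → t ≤ b → Disjoint (⋃ i, T i) (Ioc s t) →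
      x' t = x' s + ∫ r in s..t, Sys.f (x' r) (u r) := by
    intro s t has hst htb hd
    rcases hst.eq_or_lt with rfl | hst'
    · simp
    have h1 : x' t = y t := by
      rcases htb.eq_or_lt with rfl | h
      · rw [hx3, hxb' fun h => Set.disjoint_left.1 hd h ⟨hst', le_rfl⟩]
      · exact hx2 t ⟨has.trans hst, h⟩
    rw [h1, hx2 s ⟨has, hst'.trans_le htb⟩, hy t ⟨has.trans hst, htb⟩, hy s ⟨has, hst.trans htb⟩,
      ← intervalIntegral.integral_congr_ae (hae s t has hst htb), add_assoc,
      intervalIntegral.integral_add_adjacent_intervals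
        (hyint _ _ ⟨le_rfl, hab.le⟩ ⟨has, hst.trans htb⟩)
        (hyint _ _ ⟨has, hst.trans htb⟩ ⟨has.trans hst, htb⟩)]
  refine ⟨x', ⟨hxa.init, hxa.integrable.trans (hint a b le_rfl hab.le le_rfl), ?_, ?_⟩, hx1⟩
  · intro s t hs hst htb hd
    rcases le_total t a with hta | hat
    · exact hxa.integral_eq s t hs hst hta hd
    rcases le_total a s with has | hsa
    · exact key s t has hst htb hd
    have h1 := hxa.integral_eq s a hs hsa le_rfl (hd.mono_right (Ioc_subset_Ioc_right hat))
    have h2 := key a t le_rfl hat htb (hd.mono_right (Ioc_subset_Ioc_left hsa))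
    rw [h2, h1, add_assoc, intervalIntegral.integral_add_adjacent_intervals
      (hxa.integrable.mono_set ?_) (hint a t le_rfl hat htb)]
    rw [uIcc_of_le hsa, uIcc_of_le ha]
    exact Icc_subset_Icc_left hs
  · intro i t ht htb
    rcases le_or_gt t a with hta | hat
    · exact hxa.jump i t ht hta
    have htb' : t = b := by
      by_contra h
      exact Set.disjoint_left.1 hD (mem_iUnion.2 ⟨i, ht⟩) ⟨hat, lt_of_le_of_ne htb h⟩
    subst htb'
    obtain ⟨ul, hul, hg⟩ := hxb i ht
    refine ⟨y t, ul, ?_, hul, by rw [hx3, hg]⟩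
    have h1 : Tendsto y (𝓝[<] t) (𝓝 (y t)) :=
      (hyc t (right_mem_Icc.2 hab.le)).mono_of_mem_nhdsWithin (Icc_mem_nhdsLT hab)
    refine h1.congr' ?_
    filter_upwards [Ioo_mem_nhdsLT hab] with s hs
    exact (hx2 s ⟨hs.1.le, hs.2⟩).symm

/-- Solutions of the integrated equation are solutions. -/
theorem isSolution_of_isIntegralSolution (hT : IsImpulseTimes t₀ T) (hu : IsInput t₀ u)
    {x : ℝ → E} (hx : ∀ n : ℕ, Sys.IsIntegralSolution t₀ T u x₀ (t₀ + n) x) :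
    Sys.IsSolution t₀ T u x₀ x where
  init := (hx 0).init
  absolutelyContinuous a b ha hab hd := by
    obtain ⟨n, hn⟩ := exists_nat_ge (b - t₀)
    have hb : b ≤ t₀ + n := by linarith
    have heq := (hx n).integral_eq
    have hc : ContinuousOn x (Icc a b) := (hx n).continuousOn ha hab hb hd
    obtain ⟨C, hC⟩ := Sys.exists_norm_f_le hu ha hab hc
    refine LipschitzOnWith.absolutelyContinuousOnInterval (K := C) ?_
    rw [uIcc_of_le hab]
    refine LipschitzOnWith.of_dist_le_mul fun s hs t ht => ?_
    wlog hst : t ≤ s generalizing s t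
    · rw [dist_comm, dist_comm s]
      exact this t ht s hs (le_of_not_ge hst)
    rw [dist_eq_norm, heq t s (ha.trans ht.1) hst (hs.2.trans hb)
      (hd.mono_right (Ioc_subset_Ioc ht.1 hs.2)), add_sub_cancel_left, Real.dist_eq]
    refine intervalIntegral.norm_integral_le_of_norm_le_const fun r hr => ?_
    rw [uIoc_of_le hst] at hr
    exact hC r ⟨ht.1.trans hr.1.le, hr.2.trans hs.2⟩
  flow := by
    have h1 : ∀ᵐ t : ℝ, ∀ n : ℕ, t ∈ uIcc t₀ (t₀ + n) → ∀ c ∈ uIcc t₀ (t₀ + n),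
        HasDerivAt (fun s => ∫ r in c..s, Sys.f (x r) (u r)) (Sys.f (x t) (u t)) t :=
      ae_all_iff.2 fun n => (hx n).integrable.ae_hasDerivAt_integral
    have h2 : ∀ᵐ t : ℝ, t ∉ ⋃ i, T i := hT.countable_iUnion.ae_notMem volume
    filter_upwards [h1, h2] with t ht1 ht2 ht
    obtain ⟨n, hn⟩ := exists_nat_gt (t - t₀)
    have htn : t < t₀ + n := by linarith
    have hI : t ∈ Icc t₀ (t₀ + n) := ⟨ht.le, htn.le⟩
    have hd := ht1 n (by rwa [uIcc_of_le (hI.1.trans hI.2)]) t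
      (by rwa [uIcc_of_le (hI.1.trans hI.2)])
    -- Local finiteness isolates `t` from all impulses, so near `t` the solution is a primitive, and
    -- Lebesgue differentiation gives the derivative.
    have hopen : ∀ᶠ s in 𝓝 t, s ∈ ((⋃ i, T i) ∩ Ioc t₀ (t₀ + n))ᶜ :=
      (hT.finite_iUnion_inter_Ioc _ _).isClosed.isOpen_compl.mem_nhds fun h => ht2 h.1
    obtain ⟨δ, hδ, hball⟩ := Metric.eventually_nhds_iff_ball.1
      (hopen.and (Ioo_mem_nhds ht htn))
    have hno : ∀ s r, s ∈ Metric.ball t δ → r ∈ Metric.ball t δ →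
        Disjoint (⋃ i, T i) (Ioc s r) := by
      intro s r hs hr
      rw [Set.disjoint_left]
      intro q hq hqs
      have hqb : q ∈ Metric.ball t δ := by
        rw [Real.ball_eq_Ioo] at hs hr ⊢
        exact ⟨hs.1.trans hqs.1, hqs.2.trans_lt hr.2⟩
      exact (hball q hqb).1 ⟨hq, (hball q hqb).2.1, (hball q hqb).2.2.le⟩
    refine (hd.const_add (x t)).congr_of_eventuallyEq ?_
    filter_upwards [Metric.ball_mem_nhds t hδ] with s hs
    have hs' := (hball s hs).2
    have hts := Metric.mem_ball_self (x := t) hδ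
    rcases le_total t s with h | h
    · exact (hx n).integral_eq t s ht.le h hs'.2.le (hno t s hts hs)
    · rw [(hx n).integral_eq s t hs'.1.le h htn.le (hno s t hs hts),
        intervalIntegral.integral_symm s t, add_neg_cancel_right]
  jump i t ht := by
    obtain ⟨n, hn⟩ := exists_nat_ge (t - t₀)
    exact (hx n).jump i t ht (by linarith)

end

end ImpulsiveSystem

namespace IsCandidateExpISSLyapunov

open ImpulsiveSystem

variable {E U : Type*} [NormedAddCommGroup E] [InnerProductSpace ℝ E] [FiniteDimensional ℝ E]
  [MeasurableSpace E] [BorelSpace E] [NormedAddCommGroup U] [ProperSpace U] {p : ℕ} {t₀ : ℝ}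
  {u : ℝ → U} {Sys : ImpulsiveSystem E U p} {V : E → ℝ} {γ : ℝ → ℝ} {c : ℝ} {d : Fin p → ℝ}
  {T : Fin p → Set ℝ}

theorem exists_extension (hV : IsCandidateExpISSLyapunov Sys V γ c d) (hT : IsImpulseTimes t₀ T)
    (hu : IsInput t₀ u) {x₀ : E} {a b : ℝ} (ha : t₀ ≤ a) (hab : a ≤ b) {x : ℝ → E}
    (hx : Sys.IsIntegralSolution t₀ T u x₀ a x) :
    ∃ x', Sys.IsIntegralSolution t₀ T u x₀ b x' ∧ EqOn x x' (Iic a) := by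
  refine interval_induction (D := ⋃ i, T i)
    (P := fun b => ∃ x', Sys.IsIntegralSolution t₀ T u x₀ b x' ∧ EqOn x x' (Iic a)) hab
    ((hT.finite_iUnion_inter_Ioc a b).subset (inter_subset_inter_right _ Ioo_subset_Ioc_self))
    ⟨x, hx, fun _ _ => rfl⟩ ?_
  rintro s t has hst htb hd ⟨x', hx', heq⟩
  obtain ⟨y, hyc, hys, hy⟩ := hV.exists_flow hu (ha.trans has) hst.le (x' s)
  obtain ⟨x'', hx'', heq'⟩ := hx'.exists_concat hT hu (ha.trans has) hst hd hyc hys hy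
  exact ⟨x'', hx'', heq.trans (heq'.mono (Iic_subset_Iic.2 has))⟩

theorem exists_isSolution (hV : IsCandidateExpISSLyapunov Sys V γ c d)
    (hT : IsImpulseTimes t₀ T) (hu : IsInput t₀ u) (x₀ : E) :
    ∃ x, Sys.IsSolution t₀ T u x₀ x := by
  have h0 : Sys.IsIntegralSolution t₀ T u x₀ (t₀ + (0 : ℕ)) fun _ => x₀ := by
    refine ⟨rfl, by simp, fun s t hs hst ht _ => ?_, fun i t ht htb => ?_⟩
    · have : s = t := le_antisymm hst (by simp at ht; linarith)
      simp [this]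
    · have := hT.subset i ht
      simp at htb
      exact absurd this (not_lt.2 htb)
  have hstep : ∀ (n : ℕ) (x : {x // Sys.IsIntegralSolution t₀ T u x₀ (t₀ + n) x}),
      ∃ x' : {x // Sys.IsIntegralSolution t₀ T u x₀ (t₀ + (n + 1 : ℕ)) x},
        EqOn x.1 x'.1 (Iic (t₀ + n)) := by
    rintro n ⟨x, hx⟩
    obtain ⟨x', hx', heq⟩ := hV.exists_extension hT hu (a := t₀ + n) (b := t₀ + (n + 1 : ℕ))
      (by simp) (by simp) hx
    exact ⟨⟨x', hx'⟩, heq⟩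
  choose next hnext using hstep
  let X : ∀ n : ℕ, {x // Sys.IsIntegralSolution t₀ T u x₀ (t₀ + n) x} := fun n =>
    Nat.rec ⟨_, h0⟩ (fun n x => next n x) n
  have hX : ∀ m n : ℕ, m ≤ n → EqOn (X m).1 (X n).1 (Iic (t₀ + m)) := by
    intro m n hmn
    induction n, hmn using Nat.le_induction with
    | base => exact fun _ _ => rfl
    | succ n hmn ih =>
      refine ih.trans ((hnext n (X n)).mono (Iic_subset_Iic.2 ?_))
      gcongr
  -- Each extension keeps the earlier values, so at time `t` any horizon reaching `t` may be read
  -- off.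
  let x : ℝ → E := fun t => (X ⌈t - t₀⌉₊).1 t
  have hx : ∀ n : ℕ, EqOn (X n).1 x (Iic (t₀ + n)) := by
    intro n t ht
    refine (hX _ n ?_ ?_).symm
    · exact Nat.ceil_le.2 (by have := mem_Iic.1 ht; linarith)
    · have := Nat.le_ceil (t - t₀)
      exact mem_Iic.2 (by linarith)
  exact ⟨x, isSolution_of_isIntegralSolution hT hu fun n => (X n).2.congr (by simp) (hx n)⟩

end IsCandidateExpISSLyapunov

/-! ### Input-to-state stability under a dwell-time condition -/

/-- The difference between the solution and the primitive of the vector field is absolutely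
continuous with derivative zero almost everywhere, hence constant. Thus the flow estimates apply to
every solution and not only to the constructed one. -/
theorem ImpulsiveSystem.IsSolution.continuousOn_and_integral_eq {E U : Type*}
    [NormedAddCommGroup E] [InnerProductSpace ℝ E] [FiniteDimensional ℝ E] [NormedAddCommGroup U]
    [ProperSpace U] {p : ℕ} {Sys : ImpulsiveSystem E U p} {t₀ : ℝ} {T : Fin p → Set ℝ} {u : ℝ → U}
    {x₀ : E} {x : ℝ → E} (hx : Sys.IsSolution t₀ T u x₀ x) (hu : IsInput t₀ u) {a b : ℝ}
    (ha : t₀ ≤ a) (hab : a ≤ b) (hd : Disjoint (⋃ i, T i) (Ioc a b)) :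
    ContinuousOn x (Icc a b) ∧ ∀ t ∈ Icc a b, x t = x a + ∫ s in a..t, Sys.f (x s) (u s) := by
  have hac := hx.absolutelyContinuous a b ha hab hd
  have hc : ContinuousOn x (Icc a b) := by
    have := hac.continuousOn
    rwa [uIcc_of_le hab] at this
  refine ⟨hc, fun t ht => ?_⟩
  have hint : ∀ s ∈ Icc a b, ∀ t ∈ Icc a b,
      IntervalIntegrable (fun r => Sys.f (x r) (u r)) volume s t := fun s hs t ht =>
    Sys.intervalIntegrable_f hu ha hab hc hs ht
  have haI := left_mem_Icc.2 hab
  obtain ⟨C, hC⟩ := Sys.exists_norm_f_le hu ha hab hc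
  have hac' : AbsolutelyContinuousOnInterval (fun t => ∫ s in a..t, Sys.f (x s) (u s)) a b := by
    refine LipschitzOnWith.absolutelyContinuousOnInterval (K := C) ?_
    rw [uIcc_of_le hab]
    refine LipschitzOnWith.of_dist_le_mul fun s hs t ht => ?_
    rw [dist_eq_norm, intervalIntegral.integral_interval_sub_left (hint a haI s hs)
      (hint a haI t ht), Real.dist_eq]
    refine intervalIntegral.norm_integral_le_of_norm_le_const fun r hr => ?_
    exact hC r ((uIoc_subset_uIcc.trans (uIcc_subset_Icc ht hs)) hr)
  obtain ⟨K, hK⟩ := (hac.sub hac').const_of_ae_hasDerivAt_zero (by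
    have hne : ∀ᵐ r : ℝ, r ≠ a := by simp [ae_iff, measure_singleton]
    filter_upwards [hx.flow, (hint a haI b (right_mem_Icc.2 hab)).ae_hasDerivAt_integral, hne]
      with r h1 h2 hra hr
    have hr' := hr
    rw [uIcc_of_le hab] at hr'
    have hlt : a < r := lt_of_le_of_ne hr'.1 (Ne.symm hra)
    simpa using (h1 (ha.trans_lt hlt)).sub (h2 hr a left_mem_uIcc))
  rw [uIcc_of_le hab] at hK
  have h1 := hK t ht
  have h2 := hK a haI
  simp only [Pi.sub_apply, intervalIntegral.integral_same, sub_zero] at h1 h2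
  rw [h2, ← h1, sub_add_cancel]

theorem impulseCount_self (T : Set ℝ) (t : ℝ) : impulseCount T t t = 0 := by
  simp [impulseCount]

theorem impulseCount_add {T : Set ℝ} {r s t : ℝ} (hrs : r ≤ s) (hst : s ≤ t)
    (hfin : ∀ a b, (T ∩ Ioc a b).Finite) :
    impulseCount T t r = impulseCount T s r + impulseCount T t s := by
  rw [impulseCount, ← Ioc_union_Ioc_eq_Ioc hrs hst, inter_union_distrib_left,
    Set.ncard_union_eq ?_ (hfin _ _) (hfin _ _)]
  · rfl
  · exact (Ioc_disjoint_Ioc_of_le le_rfl).mono inter_subset_right inter_subset_right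

theorem impulseCount_eq_zero {T : Set ℝ} {s t : ℝ} (h : Disjoint T (Ioc s t)) :
    impulseCount T t s = 0 := by
  rw [impulseCount, Set.disjoint_iff_inter_eq_empty.1 h, ncard_empty]

namespace IsCandidateExpISSLyapunov

open ImpulsiveSystem

variable {E U : Type*} [NormedAddCommGroup E] [InnerProductSpace ℝ E] [FiniteDimensional ℝ E]
  [MeasurableSpace E] [BorelSpace E] [NormedAddCommGroup U] {p : ℕ} {t₀ : ℝ}
  {u : ℝ → U} {Sys : ImpulsiveSystem E U p} {V : E → ℝ} {γ : ℝ → ℝ} {c : ℝ} {d : Fin p → ℝ}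
  {T : Fin p → Set ℝ}

theorem exists_classKInf_le_norm (hV : IsCandidateExpISSLyapunov Sys V γ c d) :
    ∃ α, ClassKInf α ∧ ∀ x, V x ≤ α ‖x‖ := by
  refine exists_classKInf_comparison (p := fun x : E => ‖x‖) (fun x => norm_nonneg x) ?_ ?_
  · intro v
    obtain ⟨M, hM⟩ := (isCompact_closedBall (0 : E) v).exists_bound_of_continuousOn
      hV.continuous.continuousOn
    exact ⟨M, fun x hx => (Real.le_norm_self _).trans (hM x (by simpa using hx))⟩
  · intro ε hε
    have h : ∀ᶠ x in 𝓝 (0 : E), V x < ε :=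
      hV.continuous.continuousAt.eventually (gt_mem_nhds (by rwa [hV.map_zero]))
    obtain ⟨δ, hδ, hball⟩ := Metric.eventually_nhds_iff_ball.1 h
    refine ⟨δ / 2, half_pos hδ, fun x hx => (hball x ?_).le⟩
    rw [mem_ball_zero_iff]
    linarith

/-- Properness gives relatively compact sublevel sets, hence bounds on the norm. Near zero, `V` has
a positive minimum on the part of a compact set with norm at least `ε`, so small values of `V` force
small norms. -/
theorem exists_norm_le_classKInf (hV : IsCandidateExpISSLyapunov Sys V γ c d) :
    ∃ α, ClassKInf α ∧ ∀ x, ‖x‖ ≤ α (V x) := by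
  have hcomp : ∀ v, ∃ K, IsCompact K ∧ ∀ x, V x ≤ v → x ∈ K := by
    intro v
    obtain ⟨K, hK, hsub⟩ :=
      mem_cocompact.1 (hV.radiallyUnbounded.eventually (eventually_gt_atTop v))
    refine ⟨K, hK, fun x hx => ?_⟩
    by_contra hxs
    exact absurd hx (not_le.2 (hsub hxs))
  refine exists_classKInf_comparison (q := fun x : E => ‖x‖) hV.nonneg ?_ ?_
  · intro v
    obtain ⟨K, hK, hsub⟩ := hcomp v
    obtain ⟨R, hR⟩ := hK.isBounded.exists_norm_le
    exact ⟨R, fun x hx => hR x (hsub x hx)⟩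
  · intro ε hε
    obtain ⟨K, hK, hsub⟩ := hcomp 1
    have hK' : IsCompact (K ∩ {x | ε ≤ ‖x‖}) :=
      hK.inter_right (isClosed_le continuous_const continuous_norm)
    rcases (K ∩ {x | ε ≤ ‖x‖}).eq_empty_or_nonempty with he | hne
    · refine ⟨1, one_pos, fun x hx => ?_⟩
      by_contra hxε
      have : x ∈ K ∩ {x | ε ≤ ‖x‖} := ⟨hsub x hx, (not_le.1 hxε).le⟩
      rw [he] at this
      exact this
    · obtain ⟨z, ⟨_, hzε⟩, hmin⟩ := hK'.exists_isMinOn hne hV.continuous.continuousOn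
      have hz : ε ≤ ‖z‖ := hzε
      have hVz : 0 < V z := hV.pos z (norm_pos_iff.1 (hε.trans_le hz))
      refine ⟨min 1 (V z / 2), lt_min one_pos (half_pos hVz), fun x hx => ?_⟩
      by_contra hxε
      have h1 : V z ≤ V x := hmin ⟨hsub x (hx.trans (min_le_left _ _)), (not_le.1 hxε).le⟩
      have h2 := hx.trans (min_le_right _ _)
      linarith

variable [ProperSpace U]

/-- Bound of the Lyapunov function, weighted by flows and jumps, along a solution. -/
theorem comp_solution_mul_exp_le (hV : IsCandidateExpISSLyapunov Sys V γ c d)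
    (hjump : ∀ x w i, V (Sys.g i x w) ≤ max (Real.exp (-d i) * V x) (γ ‖w‖))
    (hT : IsImpulseTimes t₀ T) (hu : IsInput t₀ u) {x₀ : E} {x : ℝ → E}
    (hx : Sys.IsSolution t₀ T u x₀ x) {τ S k : ℝ} (hτ : t₀ ≤ τ)
    (hS : ∀ t ∈ Icc t₀ τ, ‖u t‖ ≤ S) (h₀ : V x₀ ≤ k)
    (hk : ∀ t ∈ Icc t₀ τ,
      γ S * Real.exp (∑ i, d i * (impulseCount (T i) t t₀ : ℝ) + c * (t - t₀)) ≤ k) :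
    V (x τ) * Real.exp (∑ i, d i * (impulseCount (T i) τ t₀ : ℝ) + c * (τ - t₀)) ≤ k := by
  -- `Ψ` accumulates the guaranteed decay exponents: it has slope `c` between impulses and jumps by
  -- `d i` at a time in `T i`, cancelling the factors in the flow and jump estimates.
  set Ψ : ℝ → ℝ := fun t => ∑ i, d i * (impulseCount (T i) t t₀ : ℝ) + c * (t - t₀) with hΨ
  have hS0 : 0 ≤ S := (norm_nonneg _).trans (hS t₀ (left_mem_Icc.2 hτ))
  have hΨadd : ∀ s t, t₀ ≤ s → s ≤ t →
      Ψ t = Ψ s + ∑ i, d i * (impulseCount (T i) t s : ℝ) + c * (t - s) := by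
    intro s t hs hst
    have : ∀ i, d i * (impulseCount (T i) t t₀ : ℝ) =
        d i * (impulseCount (T i) s t₀ : ℝ) + d i * (impulseCount (T i) t s : ℝ) := fun i => by
      rw [impulseCount_add hs hst (hT.finite i)]
      push_cast
      ring
    simp only [hΨ, this, Finset.sum_add_distrib]
    ring
  have hΨd : ∀ s t, t₀ ≤ s → s ≤ t → Disjoint (⋃ i, T i) (Ioc s t) → Ψ t = Ψ s + c * (t - s) := by
    intro s t hs hst hd
    rw [hΨadd s t hs hst, Finset.sum_eq_zero fun i _ => ?_, add_zero]
    rw [impulseCount_eq_zero (hd.mono_left (subset_iUnion T i)), Nat.cast_zero, mul_zero]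
  refine interval_induction (D := ⋃ i, T i) (P := fun t => V (x t) * Real.exp (Ψ t) ≤ k) hτ
    ((hT.finite_iUnion_inter_Ioc t₀ τ).subset (inter_subset_inter_right _ Ioo_subset_Ioc_self))
    (by simpa [hΨ, impulseCount_self, hx.init] using h₀) ?_
  intro s t hs hst htτ hd hP
  have hflow : ∀ r ∈ Icc s t, Disjoint (⋃ i, T i) (Ioc s r) →
      V (x r) ≤ k * Real.exp (-Ψ s) * Real.exp (-c * (r - s)) := by
    intro r hr hdr
    obtain ⟨hc, heq⟩ := hx.continuousOn_and_integral_eq hu hs hr.1 hdr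
    have hsub : ∀ q ∈ Icc s r, q ∈ Icc t₀ τ := fun q hq =>
      ⟨hs.trans hq.1, hq.2.trans (hr.2.trans htτ)⟩
    refine hV.flow_le hu (G := γ S) hs hc heq
      (fun q hq => hV.gain.monotoneOn (norm_nonneg _) hS0 (hS q (hsub q hq))) ?_ ?_ r
      (right_mem_Icc.2 hr.1)
    · rw [Real.exp_neg, ← div_eq_mul_inv, le_div_iff₀ (Real.exp_pos _)]
      exact hP
    · intro q hq
      have h1 := hk q (hsub q hq)
      change γ S * Real.exp (Ψ q) ≤ k at h1
      rw [hΨd s q hs hq.1 (hdr.mono_right (Ioc_subset_Ioc_right hq.2))] at h1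
      rw [mul_assoc, ← Real.exp_add, show -Ψ s + -c * (q - s) = -(Ψ s + c * (q - s)) by ring,
        Real.exp_neg, ← div_eq_mul_inv, le_div_iff₀ (Real.exp_pos _)]
      exact h1
  by_cases ht : t ∈ ⋃ i, T i
  · obtain ⟨i, hi⟩ := mem_iUnion.1 ht
    obtain ⟨xl, ul, hxl, hul, hxt⟩ := hx.jump i t hi
    -- The flow estimate holds on `[s, r]` for every `r < t` and passes to the left limit; at `t`
    -- itself the solution has already jumped.
    have hVl : V xl ≤ k * Real.exp (-Ψ s) * Real.exp (-c * (t - s)) := by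
      have hc : Continuous fun r => k * Real.exp (-Ψ s) * Real.exp (-c * (r - s)) := by fun_prop
      refine le_of_tendsto_of_tendsto ((hV.continuous.tendsto xl).comp hxl)
        ((hc.tendsto t).mono_left nhdsWithin_le_nhds) ?_
      filter_upwards [Ioo_mem_nhdsLT hst] with r hr
      refine hflow r ⟨hr.1.le, hr.2.le⟩ (hd.mono_right
        (show Ioc s r ⊆ Ioo s t from fun q hq => ⟨hq.1, hq.2.trans_lt hr.2⟩))
    have hulS : ‖ul‖ ≤ S := by
      refine le_of_tendsto hul.norm ?_
      filter_upwards [Ioo_mem_nhdsLT hst] with r hr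
      exact hS r ⟨hs.trans hr.1.le, hr.2.le.trans htτ⟩
    have hΨt : Ψ t = Ψ s + d i + c * (t - s) := by
      rw [hΨadd s t hs hst.le, Finset.sum_eq_single i]
      · have : T i ∩ Ioc s t = {t} := by
          refine Subset.antisymm (fun q hq => ?_) (singleton_subset_iff.2 ⟨hi, hst, le_rfl⟩)
          by_contra hqt
          exact Set.disjoint_left.1 hd (mem_iUnion.2 ⟨i, hq.1⟩)
            ⟨hq.2.1, lt_of_le_of_ne hq.2.2 hqt⟩
        rw [impulseCount, this, ncard_singleton, Nat.cast_one, mul_one]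
      · intro j _ hj
        rw [impulseCount_eq_zero, Nat.cast_zero, mul_zero]
        rw [Set.disjoint_left]
        intro q hq hqs
        rcases hqs.2.eq_or_lt with rfl | hlt
        · exact Set.disjoint_left.1 (hT.disjoint j i hj) hq hi
        · exact Set.disjoint_left.1 hd (mem_iUnion.2 ⟨j, hq⟩) ⟨hqs.1, hlt⟩
      · simp
    rw [hxt]
    -- If the old state dominates, the factor `exp (-d i)` cancels the jump of `Ψ`. If the input
    -- dominates, `hk` at time `t` applies directly. The implication-form jump condition alone would
    -- say nothing in the second case.
    rcases le_max_iff.1 (hjump xl ul i) with h | h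
    · calc V (Sys.g i xl ul) * Real.exp (Ψ t)
          ≤ (Real.exp (-d i) * (k * Real.exp (-Ψ s) * Real.exp (-c * (t - s)))) *
            Real.exp (Ψ t) := by
            gcongr
            exact h.trans (by gcongr)
        _ = k * Real.exp (-d i + -Ψ s + -c * (t - s) + Ψ t) := by
            simp only [Real.exp_add]
            ring
        _ = k := by
            rw [hΨt, show -d i + -Ψ s + -c * (t - s) + (Ψ s + d i + c * (t - s)) = 0 by ring,
              Real.exp_zero, mul_one]
    · refine le_trans ?_ (hk t ⟨hs.trans hst.le, htτ⟩)
      gcongr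
      exact h.trans (hV.gain.monotoneOn (norm_nonneg _) hS0 hulS)
  · have hd' : Disjoint (⋃ i, T i) (Ioc s t) := by
      rw [Set.disjoint_left]
      intro q hq hqs
      rcases hqs.2.eq_or_lt with rfl | hlt
      · exact ht hq
      · exact Set.disjoint_left.1 hd hq ⟨hqs.1, hlt⟩
    calc V (x t) * Real.exp (Ψ t)
        ≤ k * Real.exp (-Ψ s) * Real.exp (-c * (t - s)) * Real.exp (Ψ t) := by
          gcongr
          exact hflow t (right_mem_Icc.2 hst.le) hd'
      _ = k * Real.exp (-Ψ s + -c * (t - s) + Ψ t) := by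
          simp only [Real.exp_add]
          ring
      _ = k := by
          rw [hΨd s t hs hst.le hd', show -Ψ s + -c * (t - s) + (Ψ s + c * (t - s)) = 0 by ring,
            Real.exp_zero, mul_one]

/-- Under the dwell-time condition, the Lyapunov function decays exponentially up to an error
determined by the input. -/
theorem comp_solution_le (hV : IsCandidateExpISSLyapunov Sys V γ c d)
    (hjump : ∀ x w i, V (Sys.g i x w) ≤ max (Real.exp (-d i) * V x) (γ ‖w‖)) {μ lam : ℝ}
    (hlam : 0 < lam) (hT : T ∈ dwellTimeClass t₀ c d μ lam) (hu : IsInput t₀ u) {x₀ : E}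
    {x : ℝ → E} (hx : Sys.IsSolution t₀ T u x₀ x) {t : ℝ} (ht : t₀ ≤ t) :
    V (x t) ≤ max (Real.exp (μ - lam * (t - t₀)) * V x₀) (Real.exp μ * γ (supNorm u t₀ t)) := by
  obtain ⟨hT, hdwell⟩ := hT
  set Ψ : ℝ → ℝ := fun t => ∑ i, d i * (impulseCount (T i) t t₀ : ℝ) + c * (t - t₀) with hΨ
  have hΨle : ∀ s ∈ Icc t₀ t, Ψ s - Ψ t ≤ μ - lam * (t - s) := by
    intro s hs
    have h1 := hdwell s t hs.1 hs.2
    have : ∀ i, d i * (impulseCount (T i) t t₀ : ℝ) =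
        d i * (impulseCount (T i) s t₀ : ℝ) + d i * (impulseCount (T i) t s : ℝ) := fun i => by
      rw [impulseCount_add hs.1 hs.2 (hT.finite i)]
      push_cast
      ring
    simp only [hΨ, this, Finset.sum_add_distrib]
    linarith
  have hΨ0 : Ψ t₀ = 0 := by simp [hΨ, impulseCount_self]
  have hg0 : 0 ≤ γ (supNorm u t₀ t) := hV.gain.nonneg (hu.supNorm_nonneg ht)
  -- The second entry of `k` works because `Ψ s ≤ Ψ t + μ` for all earlier `s`; dividing by `exp (Ψ
  -- t)` leaves `exp μ` on the input and the full decay on `V x₀`.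
  have key := hV.comp_solution_mul_exp_le hjump hT hu hx ht (S := supNorm u t₀ t)
    (k := max (V x₀) (γ (supNorm u t₀ t) * Real.exp (Ψ t + μ)))
    (fun s hs => hu.norm_le_supNorm hs) (le_max_left _ _) (fun s hs => by
      refine le_trans ?_ (le_max_right _ _)
      have h1 := hΨle s hs
      have h2 : 0 ≤ lam * (t - s) := mul_nonneg hlam.le (sub_nonneg.2 hs.2)
      change _ * Real.exp (Ψ s) ≤ _
      gcongr
      linarith)
  change V (x t) * Real.exp (Ψ t) ≤ _ at key
  rw [← le_div_iff₀ (Real.exp_pos _), div_eq_mul_inv, ← Real.exp_neg,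
    max_mul_of_nonneg _ _ (Real.exp_nonneg _)] at key
  refine key.trans (max_le_max ?_ (le_of_eq ?_))
  · rw [mul_comm]
    gcongr
    · exact hV.nonneg _
    · have := hΨle t₀ (left_mem_Icc.2 ht)
      linarith
  · rw [mul_assoc, ← Real.exp_add, add_neg_cancel_comm, mul_comm]

/-- A candidate exponential ISS-Lyapunov function whose value after a jump is controlled by the
input yields uniform ISS over the impulse times with a dwell-time condition. -/
theorem uniformlyISS (hV : IsCandidateExpISSLyapunov Sys V γ c d)
    (hjump : ∀ x w i, V (Sys.g i x w) ≤ max (Real.exp (-d i) * V x) (γ ‖w‖)) (t₀ μ : ℝ)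
    {lam : ℝ} (hlam : 0 < lam) : Sys.UniformlyISS t₀ (dwellTimeClass t₀ c d μ lam) := by
  obtain ⟨α, hα, hVα⟩ := hV.exists_classKInf_le_norm
  obtain ⟨ψ, hψ, hψV⟩ := hV.exists_norm_le_classKInf
  refine ⟨fun r t => ψ (Real.exp (μ - lam * t) * α r), fun r => ψ (Real.exp μ * γ r),
    ⟨?_, fun t _ => ?_, fun r hr s _ t _ hst => ?_, fun r hr => ?_⟩,
    hψ.comp (hV.gain.const_mul (Real.exp_pos μ)), fun T hT x₀ u hu =>
      ⟨hV.exists_isSolution hT.1 hu x₀, fun x hx t ht => ?_⟩⟩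
  · refine hψ.continuousOn.comp (ContinuousOn.mul (Continuous.continuousOn (by fun_prop))
      (hα.continuousOn.comp continuous_fst.continuousOn fun q hq => hq.1)) fun q hq => ?_
    exact mul_nonneg (Real.exp_nonneg _) (hα.nonneg hq.1)
  · exact hψ.toClassK.comp (hα.toClassK.const_mul (Real.exp_pos _))
  · have hαr := hα.nonneg hr
    refine hψ.monotoneOn (mem_Ici.2 (by positivity)) (mem_Ici.2 (by positivity)) ?_
    gcongr
  · have h1 : Tendsto (fun t => Real.exp (μ - lam * t) * α r) atTop (𝓝 0) := by
      have h2 : Tendsto (fun t => μ - lam * t) atTop atBot :=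
        tendsto_const_nhds.add_atBot
          (tendsto_neg_atTop_atBot.comp (tendsto_id.const_mul_atTop hlam))
      simpa using (Real.tendsto_exp_atBot.comp h2).mul_const (α r)
    have h3 : Tendsto (fun t => Real.exp (μ - lam * t) * α r) atTop (𝓝[≥] 0) :=
      tendsto_nhdsWithin_iff.2 ⟨h1, Eventually.of_forall fun t =>
        mul_nonneg (Real.exp_nonneg _) (hα.nonneg hr)⟩
    have h4 := (hψ.continuousOn 0 (mem_Ici.2 le_rfl)).tendsto.comp h3
    rwa [hψ.map_zero] at h4
  · have hVx := hV.nonneg (x t)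
    rcases le_max_iff.1 (hV.comp_solution_le hjump hlam hT hu hx ht) with h | h
    · refine le_max_of_le_left ((hψV _).trans (hψ.monotoneOn hVx ?_ ?_))
      · exact mul_nonneg (Real.exp_nonneg _) (hα.nonneg (norm_nonneg _))
      · exact h.trans (by gcongr; exact hVα x₀)
    · exact le_max_of_le_right ((hψV _).trans (hψ.monotoneOn hVx
        (mul_nonneg (Real.exp_nonneg _) (hV.gain.nonneg (hu.supNorm_nonneg ht))) h))

end IsCandidateExpISSLyapunov

/-! ### The small-gain theorem -/

/-- Rademacher's theorem for functions that are locally Lipschitz away from the origin. -/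
theorem LocallyLipschitzOn.ae_differentiableAt_of_compl_zero {E : Type*} [NormedAddCommGroup E]
    [InnerProductSpace ℝ E] [FiniteDimensional ℝ E] [MeasurableSpace E] [BorelSpace E] {V : E → ℝ}
    (hV : LocallyLipschitzOn {0}ᶜ V) : ∀ᵐ x : E, DifferentiableAt ℝ V x := by
  -- In dimension zero the origin is not a null set and must be treated separately.
  rcases subsingleton_or_nontrivial E with hE | hE
  · exact Eventually.of_forall fun x => (hasFDerivAt_of_subsingleton V x).differentiableAt
  have h0 : ∀ᵐ x : E, x ≠ 0 := by simp [ae_iff, measure_singleton]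
  have h1 : volume {x : E | x ≠ 0 ∧ ¬ DifferentiableAt ℝ V x} = 0 := by
    refine measure_null_of_locally_null _ fun x hx => ?_
    obtain ⟨K, t, ht, hK⟩ := hV hx.1
    rw [isOpen_compl_singleton.nhdsWithin_eq hx.1] at ht
    obtain ⟨s, hst, hs, hxs⟩ := mem_nhds_iff.1 ht
    refine ⟨_, inter_mem_nhdsWithin _ (hs.mem_nhds hxs), ?_⟩
    have h2 := (hK.mono hst).ae_differentiableWithinAt_of_mem (μ := volume)
    refine measure_mono_null ?_ (ae_iff.1 h2)
    rintro y ⟨hy, hys⟩ h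
    exact hy.2 ((h hys).differentiableAt (hs.mem_nhds hys))
  have h2 : ∀ᵐ x : E, ¬ (x ≠ 0 ∧ ¬ DifferentiableAt ℝ V x) := by
    rw [ae_iff]
    simpa only [not_not] using h1
  filter_upwards [h0, h2] with x hx hx'
  by_contra h
  exact hx' ⟨hx, h⟩

/-- Surjective linear maps pull null sets back to null sets, so Rademacher's theorem for a
subsystem's function holds at almost every state of the product space. -/
theorem ae_differentiableAt_comp_of_surjective {E F : Type*} [NormedAddCommGroup E]
    [InnerProductSpace ℝ E] [FiniteDimensional ℝ E] [MeasurableSpace E] [BorelSpace E]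
    [NormedAddCommGroup F] [InnerProductSpace ℝ F] [FiniteDimensional ℝ F] [MeasurableSpace F]
    [BorelSpace F] {V : F → ℝ} (hV : LocallyLipschitzOn {0}ᶜ V) (L : E →L[ℝ] F)
    (hL : Function.Surjective L) : ∀ᵐ x : E, DifferentiableAt ℝ V (L x) :=
  (ae_comp_linearMap_mem_iff (L := (L : E →ₗ[ℝ] F)) volume volume hL
    (measurableSet_of_differentiableAt ℝ V)).2 hV.ae_differentiableAt_of_compl_zero

/-- Where a function touches a smaller one, their derivatives agree. -/
theorem fderiv_apply_eq_of_touching {E F : Type*} [NormedAddCommGroup E] [NormedSpace ℝ E]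
    [NormedAddCommGroup F] [NormedSpace ℝ F] {V : E → ℝ} {W : F → ℝ} (L : E →L[ℝ] F) {σ : ℝ}
    {x : E} (hV : DifferentiableAt ℝ V x) (hW : DifferentiableAt ℝ W (L x))
    (hle : ∀ y, σ * W (L y) ≤ V y) (heq : σ * W (L x) = V x) (v : E) :
    fderiv ℝ V x v = σ * fderiv ℝ W (L x) (L v) := by
  have h1 : HasFDerivAt (fun y => V y - σ * W (L y))
      (fderiv ℝ V x - σ • (fderiv ℝ W (L x)).comp L) x :=
    hV.hasFDerivAt.sub ((hW.hasFDerivAt.comp x L.hasFDerivAt).const_mul σ)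
  have hmin : IsLocalMin (fun y => V y - σ * W (L y)) x :=
    Eventually.of_forall fun y => by
      beta_reduce
      rw [heq, sub_self]
      exact sub_nonneg.2 (hle y)
  have h2 := congrArg (fun A : E →L[ℝ] ℝ => A v) (hmin.hasFDerivAt_eq_zero h1)
  simpa [sub_eq_zero] using h2

theorem LocallyLipschitzOn.max {X : Type*} [PseudoEMetricSpace X] {s : Set X} {V W : X → ℝ}
    (hV : LocallyLipschitzOn s V) (hW : LocallyLipschitzOn s W) :
    LocallyLipschitzOn s fun x => max (V x) (W x) := by
  intro x hx
  obtain ⟨K, t, ht, hK⟩ := hV hx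
  obtain ⟨K', t', ht', hK'⟩ := hW hx
  exact ⟨_, _, inter_mem ht ht', lipschitzWith_max.comp_lipschitzOnWith
    ((hK.mono inter_subset_left).prodMk (hK'.mono inter_subset_right))⟩

theorem LocallyLipschitzOn.comp_lipschitzWith {X Y : Type*} [PseudoEMetricSpace X]
    [PseudoEMetricSpace Y] {s : Set X} {t : Set Y} {V : Y → ℝ} (hV : LocallyLipschitzOn t V)
    {K : ℝ≥0} {L : X → Y} (hL : LipschitzWith K L) (hst : MapsTo L s t) (σ : ℝ) :
    LocallyLipschitzOn s fun x => σ * V (L x) := by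
  intro x hx
  obtain ⟨K', r, hr, hK'⟩ := hV (hst hx)
  exact ⟨_, L ⁻¹' r, hL.continuous.continuousWithinAt.tendsto_nhdsWithin hst hr,
    (lipschitzWith_smul σ).comp_lipschitzOnWith
      (hK'.comp (hL.lipschitzOnWith) (mapsTo_preimage L r))⟩

/-! ### The scaled maximum on the product space. -/

section SmallGain

variable {N₁ N₂ M₁ M₂ : ℕ} {Sys : InterconnectedSystem N₁ N₂ M₁ M₂}
  {V₁ : EuclideanSpace ℝ (Fin N₁) → ℝ} {V₂ : EuclideanSpace ℝ (Fin N₂) → ℝ}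
  {c₁ c₂ dh₁ dh₂ γ₁₂ γ₂₁ σ : ℝ} {γ₁ γ₂ : ℝ → ℝ}

namespace IsSubsystemExpISSLyapunov

theorem nonneg {n m k : ℕ} {own : EuclideanProd N₁ N₂ → EuclideanSpace ℝ (Fin n)}
    {other : EuclideanProd N₁ N₂ → EuclideanSpace ℝ (Fin m)}
    {f g : EuclideanProd N₁ N₂ → EuclideanSpace ℝ (Fin k) → EuclideanSpace ℝ (Fin n)}
    {V : EuclideanSpace ℝ (Fin n) → ℝ} {W : EuclideanSpace ℝ (Fin m) → ℝ} {c d : ℝ}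
    {γ γe : ℝ → ℝ} (h : IsSubsystemExpISSLyapunov own other f g V W c d γ γe)
    (y : EuclideanSpace ℝ (Fin n)) : 0 ≤ V y := by
  rcases eq_or_ne y 0 with rfl | hy
  · rw [h.map_zero]
  · exact (h.pos y hy).le

/-- Decrease of the maximum of two Lyapunov functions where it is attained by `σ * V`. -/
theorem fderiv_le {n m k : ℕ} {own : EuclideanProd N₁ N₂ →L[ℝ] EuclideanSpace ℝ (Fin n)}
    {other : EuclideanProd N₁ N₂ → EuclideanSpace ℝ (Fin m)}
    {f g : EuclideanProd N₁ N₂ → EuclideanSpace ℝ (Fin k) → EuclideanSpace ℝ (Fin n)}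
    {V : EuclideanSpace ℝ (Fin n) → ℝ} {W : EuclideanSpace ℝ (Fin m) → ℝ} {c d c' : ℝ}
    {γ γe : ℝ → ℝ} (h : IsSubsystemExpISSLyapunov own other f g V W c d γ γe)
    {Z : EuclideanProd N₁ N₂ → ℝ} (hσ : 0 < σ) (hc : c' ≤ c) {x v : EuclideanProd N₁ N₂}
    {w : EuclideanSpace ℝ (Fin k)} (hZ : DifferentiableAt ℝ Z x)
    (hV : DifferentiableAt ℝ V (own x)) (hle : ∀ y, σ * V (own y) ≤ Z y)
    (heq : σ * V (own x) = Z x) (hv : own v = f x w)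
    (hdec : ∀ u, max (γ (W (other x))) (γe ‖u‖) ≤ V (own x) →
      fderiv ℝ V (own x) (f x u) ≤ -c * V (own x))
    (hγ : σ * γ (W (other x)) ≤ Z x) (hγe : σ * γe ‖w‖ ≤ Z x) :
    fderiv ℝ Z x v ≤ -c' * Z x := by
  have h1 := hdec w (max_le (le_of_mul_le_mul_left (hγ.trans_eq heq.symm) hσ)
    (le_of_mul_le_mul_left (hγe.trans_eq heq.symm) hσ))
  have h2 := h.nonneg (own x)
  rw [fderiv_apply_eq_of_touching own hZ hV hle heq, hv, ← heq]
  calc σ * fderiv ℝ V (own x) (f x w) ≤ σ * (-c * V (own x)) := by gcongr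
    _ = -c * (σ * V (own x)) := by ring
    _ ≤ -c' * (σ * V (own x)) := by gcongr

/-- Jump estimate for the maximum of two Lyapunov functions. -/
theorem mul_jump_le {n m k : ℕ} {own : EuclideanProd N₁ N₂ → EuclideanSpace ℝ (Fin n)}
    {other : EuclideanProd N₁ N₂ → EuclideanSpace ℝ (Fin m)}
    {f g : EuclideanProd N₁ N₂ → EuclideanSpace ℝ (Fin k) → EuclideanSpace ℝ (Fin n)}
    {V : EuclideanSpace ℝ (Fin n) → ℝ} {W : EuclideanSpace ℝ (Fin m) → ℝ} {c d : ℝ}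
    {γ γe : ℝ → ℝ} (h : IsSubsystemExpISSLyapunov own other f g V W c d γ γe) (hσ : 0 < σ)
    {x : EuclideanProd N₁ N₂} {w : EuclideanSpace ℝ (Fin k)} {D z r : ℝ}
    (hz : σ * V (own x) ≤ z) (hD : Real.exp (-d) ≤ D) (hγ : σ * γ (W (other x)) ≤ D * z)
    (hγe : σ * γe ‖w‖ ≤ r) : σ * V (g x w) ≤ max (D * z) r := by
  have hV := h.nonneg (own x)
  have hD0 : 0 ≤ D := (Real.exp_nonneg _).trans hD
  calc σ * V (g x w)
      ≤ σ * max (Real.exp (-d) * V (own x)) (max (γ (W (other x))) (γe ‖w‖)) := by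
        gcongr
        exact h.jump x w
    _ = max (Real.exp (-d) * (σ * V (own x))) (max (σ * γ (W (other x))) (σ * γe ‖w‖)) := by
        rw [mul_max_of_nonneg _ _ hσ.le, mul_max_of_nonneg _ _ hσ.le]
        congr 1
        ring
    _ ≤ max (D * z) (max (D * z) r) := by gcongr
    _ = max (D * z) r := by rw [← max_assoc, max_self]

end IsSubsystemExpISSLyapunov

variable (hV₁ : IsSubsystemExpISSLyapunov (fun x => x.fst) (fun x => x.snd) Sys.f₁ Sys.g₁ V₁ V₂
    c₁ dh₁ (fun r => γ₁₂ * r) γ₁)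
  (hV₂ : IsSubsystemExpISSLyapunov (fun x => x.snd) (fun x => x.fst) Sys.f₂ Sys.g₂ V₂ V₁
    c₂ dh₂ (fun r => γ₂₁ * r) γ₂)

include hV₁ hV₂

/-- A branch may fail to be Lipschitz where its own component vanishes. Away from the origin the
other component is then nonzero, and its branch strictly dominates nearby, so the bad branch is not
seen by the maximum. -/
theorem locallyLipschitzOn_max_comp (hσ : 0 < σ) :
    LocallyLipschitzOn {0}ᶜ fun x : EuclideanProd N₁ N₂ => max (σ * V₁ x.fst) (V₂ x.snd) := by
  have hfst := (WithLp.fstL 2 ℝ (EuclideanSpace ℝ (Fin N₁)) (EuclideanSpace ℝ (Fin N₂))).lipschitz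
  have hsnd := (WithLp.sndL 2 ℝ (EuclideanSpace ℝ (Fin N₁)) (EuclideanSpace ℝ (Fin N₂))).lipschitz
  have h₁ : LocallyLipschitzOn {x : EuclideanProd N₁ N₂ | x.fst ≠ 0} fun x => σ * V₁ x.fst :=
    hV₁.locallyLipschitzOn.comp_lipschitzWith hfst (fun x hx => hx) σ
  have h₂ : LocallyLipschitzOn {x : EuclideanProd N₁ N₂ | x.snd ≠ 0} fun x => V₂ x.snd := by
    have h := hV₂.locallyLipschitzOn.comp_lipschitzWith
      (s := {x : EuclideanProd N₁ N₂ | x.snd ≠ 0}) hsnd (fun x hx => hx) 1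
    simp only [one_mul] at h
    exact h
  have hc₁ : Continuous fun x : EuclideanProd N₁ N₂ => σ * V₁ x.fst :=
    continuous_const.mul (hV₁.continuous.comp hfst.continuous)
  have hc₂ : Continuous fun x : EuclideanProd N₁ N₂ => V₂ x.snd :=
    hV₂.continuous.comp hsnd.continuous
  have ho₁ : IsOpen {x : EuclideanProd N₁ N₂ | x.fst ≠ 0} :=
    isOpen_compl_singleton.preimage hfst.continuous
  have ho₂ : IsOpen {x : EuclideanProd N₁ N₂ | x.snd ≠ 0} :=
    isOpen_compl_singleton.preimage hsnd.continuous
  intro x hx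
  rw [isOpen_compl_singleton.nhdsWithin_eq hx]
  by_cases hx₁ : x.fst = 0
  · have hx₂ : x.snd ≠ 0 := by
      intro hx₂
      refine hx ?_
      rw [mem_singleton_iff, ← WithLp.ofLp_eq_zero 2]
      exact Prod.ext hx₁ hx₂
    obtain ⟨K, t, ht, hK⟩ := h₂ hx₂
    rw [ho₂.nhdsWithin_eq hx₂] at ht
    have hlt : ∀ᶠ y in 𝓝 x, σ * V₁ y.fst < V₂ y.snd :=
      hc₁.continuousAt.eventually_lt hc₂.continuousAt (by
        rw [hx₁, hV₁.map_zero, mul_zero]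
        exact hV₂.pos _ hx₂)
    refine ⟨K, _, inter_mem ht hlt, ?_⟩
    intro y hy z hz
    beta_reduce
    rw [max_eq_right (le_of_lt (show _ < _ from hy.2)), max_eq_right (le_of_lt (show _ < _ from hz.2))]
    exact hK hy.1 hz.1
  by_cases hx₂ : x.snd = 0
  · obtain ⟨K, t, ht, hK⟩ := h₁ hx₁
    rw [ho₁.nhdsWithin_eq hx₁] at ht
    have hlt : ∀ᶠ y in 𝓝 x, V₂ y.snd < σ * V₁ y.fst :=
      hc₂.continuousAt.eventually_lt hc₁.continuousAt (by
        rw [hx₂, hV₂.map_zero]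
        exact mul_pos hσ (hV₁.pos _ hx₁))
    refine ⟨K, _, inter_mem ht hlt, ?_⟩
    intro y hy z hz
    beta_reduce
    rw [max_eq_left (le_of_lt (show _ < _ from hy.2)), max_eq_left (le_of_lt (show _ < _ from hz.2))]
    exact hK hy.1 hz.1
  · have h := (h₁.mono inter_subset_left).max (h₂.mono inter_subset_right) (x := x) ⟨hx₁, hx₂⟩
    rwa [(ho₁.inter ho₂).nhdsWithin_eq ⟨hx₁, hx₂⟩] at h

theorem tendsto_max_comp_cocompact (hσ : 0 < σ) :
    Tendsto (fun x : EuclideanProd N₁ N₂ => max (σ * V₁ x.fst) (V₂ x.snd)) (cocompact _)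
      atTop := by
  refine tendsto_atTop.2 fun M => ?_
  obtain ⟨K₁, hK₁, hs₁⟩ := mem_cocompact.1
    ((hV₁.proper.const_mul_atTop hσ).eventually (eventually_ge_atTop M))
  obtain ⟨K₂, hK₂, hs₂⟩ := mem_cocompact.1 (hV₂.proper.eventually (eventually_ge_atTop M))
  refine mem_cocompact.2 ⟨_, (hK₁.prod hK₂).image (WithLp.prodContinuousLinearEquiv 2 ℝ
    (EuclideanSpace ℝ (Fin N₁)) (EuclideanSpace ℝ (Fin N₂))).symm.continuous, fun x hx => ?_⟩
  have : ¬ (x.fst ∈ K₁ ∧ x.snd ∈ K₂) := fun h => hx ⟨(x.fst, x.snd), h, rfl⟩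
  rcases not_and_or.1 this with h | h
  · have h' : M ≤ σ * V₁ x.fst := hs₁ h
    exact le_max_of_le_left h'
  · have h' : M ≤ V₂ x.snd := hs₂ h
    exact le_max_of_le_right h'

/-- The maximum of the scaled Lyapunov functions of the subsystems is a Lyapunov function of the
interconnection, if the scaling factor is compatible with the internal gains. -/
theorem isCandidateExpISSLyapunov_max (hσ : 0 < σ) (hσ₁₂ : σ * γ₁₂ ≤ 1) (hσ₂₁ : γ₂₁ ≤ σ)
    {C : ℝ} {d : Fin 3 → ℝ} (hC : 1 ≤ C)
    (hdC : ∀ i, Real.exp (d i) ≤ C)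
    (hjump : ∀ x u i, max (σ * V₁ (Sys.toImpulsiveSystem.g i x u).fst)
        (V₂ (Sys.toImpulsiveSystem.g i x u).snd) ≤
      max (Real.exp (-d i) * max (σ * V₁ x.fst) (V₂ x.snd)) (max (σ * γ₁ ‖u‖) (γ₂ ‖u‖))) :
    IsCandidateExpISSLyapunov Sys.toImpulsiveSystem
      (fun x : EuclideanProd N₁ N₂ => max (σ * V₁ x.fst) (V₂ x.snd))
      (fun r => C * max (σ * γ₁ r) (γ₂ r)) (min c₁ c₂) d := by
  have hfst := (WithLp.fstL 2 ℝ (EuclideanSpace ℝ (Fin N₁)) (EuclideanSpace ℝ (Fin N₂))).continuous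
  have hsnd := (WithLp.sndL 2 ℝ (EuclideanSpace ℝ (Fin N₁)) (EuclideanSpace ℝ (Fin N₂))).continuous
  have hLip := locallyLipschitzOn_max_comp hV₁ hV₂ hσ
  have hgain : ClassKInf fun r => max (σ * γ₁ r) (γ₂ r) :=
    (hV₁.externalGain.const_mul hσ).max hV₂.externalGain
  have hC0 : 0 < C := one_pos.trans_le hC
  refine ⟨(continuous_const.mul (hV₁.continuous.comp hfst)).max (hV₂.continuous.comp hsnd), hLip,
    ?_, fun x hx => ?_, tendsto_max_comp_cocompact hV₁ hV₂ hσ, hgain.const_mul hC0, ?_, ?_⟩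
  · simp [hV₁.map_zero, hV₂.map_zero]
  · by_cases hx₁ : x.fst = 0
    · refine lt_max_of_lt_right (hV₂.pos _ fun hx₂ => hx ?_)
      rw [← WithLp.ofLp_eq_zero 2]
      exact Prod.ext hx₁ hx₂
    · exact lt_max_of_lt_left (mul_pos hσ (hV₁.pos _ hx₁))
  · have hd := hLip.ae_differentiableAt_of_compl_zero
    have hd₁ := ae_differentiableAt_comp_of_surjective hV₁.locallyLipschitzOn
      (WithLp.fstL 2 ℝ (EuclideanSpace ℝ (Fin N₁)) (EuclideanSpace ℝ (Fin N₂)))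
      fun y => ⟨WithLp.toLp 2 (y, 0), rfl⟩
    have hd₂ := ae_differentiableAt_comp_of_surjective hV₂.locallyLipschitzOn
      (WithLp.sndL 2 ℝ (EuclideanSpace ℝ (Fin N₁)) (EuclideanSpace ℝ (Fin N₂)))
      fun y => ⟨WithLp.toLp 2 (0, y), rfl⟩
    filter_upwards [hd, hd₁, hd₂, hV₁.flow, hV₂.flow] with x hdx hdx₁ hdx₂ hf₁ hf₂ u hu
    have hu' : max (σ * γ₁ ‖u‖) (γ₂ ‖u‖) ≤ max (σ * V₁ x.fst) (V₂ x.snd) :=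
      (le_mul_of_one_le_left (hgain.nonneg (norm_nonneg u)) hC).trans hu
    have hV₁x := hV₁.nonneg x.fst
    have hV₂x := hV₂.nonneg x.snd
    -- On the active branch the small-gain inequalities `σ γ₁₂ ≤ 1` and `γ₂₁ ≤ σ` supply the
    -- internal premise of that subsystem, and `hu'` the external one.
    rcases le_total (V₂ x.snd) (σ * V₁ x.fst) with h | h
    · refine hV₁.fderiv_le (own := WithLp.fstL 2 ℝ _ _) (w := u.fst) hσ (min_le_left _ _) hdx hdx₁
        (fun y => le_max_left _ _) (max_eq_left h).symm rfl hf₁ ?_ ?_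
      · refine le_trans ?_ (le_max_right _ _)
        rw [← mul_assoc]
        exact mul_le_of_le_one_left hV₂x hσ₁₂
      · refine le_trans ?_ ((le_max_left _ _).trans hu')
        gcongr
        exact hV₁.externalGain.monotoneOn (norm_nonneg _) (norm_nonneg _) (WithLp.norm_fst_le _ u)
    · refine hV₂.fderiv_le (own := WithLp.sndL 2 ℝ _ _) (w := u.snd) one_pos (min_le_right _ _) hdx
        hdx₂ (fun y => (one_mul _).trans_le (le_max_right _ _))
        ((one_mul _).trans (max_eq_right h).symm) rfl hf₂ ?_ ?_
      · refine le_trans ?_ (le_max_left _ _)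
        rw [one_mul]
        gcongr
      · refine le_trans ?_ ((le_max_right _ _).trans hu')
        rw [one_mul]
        exact hV₂.externalGain.monotoneOn (norm_nonneg _) (norm_nonneg _) (WithLp.norm_snd_le _ u)
  · intro x u hu i
    -- The input term is absorbed because `exp (-d i) * C ≥ 1`; this is why the gain carries the
    -- factors `exp (d i)`.
    refine (hjump x u i).trans (max_le le_rfl ?_)
    refine le_trans ?_ (mul_le_mul_of_nonneg_left hu (Real.exp_nonneg _))
    rw [← mul_assoc]
    refine le_mul_of_one_le_left (hgain.nonneg (norm_nonneg u)) ?_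
    calc (1 : ℝ) = Real.exp (-d i) * Real.exp (d i) := by rw [← Real.exp_add]; simp
      _ ≤ Real.exp (-d i) * C := by gcongr; exact hdC i

/-- When only one subsystem jumps, the other component is unchanged, which forces `1 ≤ exp (-d i)`.
When both jump there is no such constraint, and the third rate may be positive. -/
theorem jump_max_le (hσ : 0 < σ) (hγ₁₂ : 0 < γ₁₂) {d : Fin 3 → ℝ}
    (h₀ : 1 ≤ Real.exp (-d 0) ∧ Real.exp (-dh₁) ≤ Real.exp (-d 0) ∧ σ * γ₁₂ ≤ Real.exp (-d 0))
    (h₁ : 1 ≤ Real.exp (-d 1) ∧ Real.exp (-dh₂) ≤ Real.exp (-d 1) ∧ γ₂₁ ≤ σ * Real.exp (-d 1))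
    (h₂ : Real.exp (-dh₁) ≤ Real.exp (-d 2) ∧ σ * γ₁₂ ≤ Real.exp (-d 2) ∧
      Real.exp (-dh₂) ≤ Real.exp (-d 2) ∧ γ₂₁ ≤ σ * Real.exp (-d 2))
    (x : EuclideanProd N₁ N₂) (u : EuclideanProd M₁ M₂) (i : Fin 3) :
    max (σ * V₁ (Sys.toImpulsiveSystem.g i x u).fst) (V₂ (Sys.toImpulsiveSystem.g i x u).snd) ≤
      max (Real.exp (-d i) * max (σ * V₁ x.fst) (V₂ x.snd)) (max (σ * γ₁ ‖u‖) (γ₂ ‖u‖)) := by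
  set z := max (σ * V₁ x.fst) (V₂ x.snd) with hz
  have hV₁x := hV₁.nonneg x.fst
  have hV₂x := hV₂.nonneg x.snd
  have hz0 : 0 ≤ z := hV₂x.trans (le_max_right _ _)
  have key₁ : ∀ D, Real.exp (-dh₁) ≤ D → σ * γ₁₂ ≤ D →
      σ * V₁ (Sys.g₁ x u.fst) ≤ max (D * z) (max (σ * γ₁ ‖u‖) (γ₂ ‖u‖)) := by
    intro D hD hD'
    refine hV₁.mul_jump_le hσ (le_max_left _ _) hD ?_ (le_trans ?_ (le_max_left _ _))
    · have : 0 ≤ σ * γ₁₂ := by positivity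
      calc σ * (γ₁₂ * V₂ x.snd) = σ * γ₁₂ * V₂ x.snd := by ring
        _ ≤ D * z := mul_le_mul hD' (le_max_right _ _) hV₂x (this.trans hD')
    · gcongr
      exact hV₁.externalGain.monotoneOn (norm_nonneg _) (norm_nonneg _) (WithLp.norm_fst_le _ u)
  have key₂ : ∀ D, Real.exp (-dh₂) ≤ D → γ₂₁ ≤ σ * D →
      V₂ (Sys.g₂ x u.snd) ≤ max (D * z) (max (σ * γ₁ ‖u‖) (γ₂ ‖u‖)) := by
    intro D hD hD'
    have hD0 : 0 ≤ D := (Real.exp_nonneg _).trans hD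
    have h := hV₂.mul_jump_le (x := x) (w := u.snd) (z := z) one_pos
      ((one_mul _).trans_le (le_max_right _ _)) hD
      (r := max (σ * γ₁ ‖u‖) (γ₂ ‖u‖)) ?_ (le_trans ?_ (le_max_right _ _))
    · rwa [one_mul] at h
    · calc 1 * (γ₂₁ * V₁ x.fst) = γ₂₁ * V₁ x.fst := one_mul _
        _ ≤ σ * D * V₁ x.fst := by gcongr
        _ = D * (σ * V₁ x.fst) := by ring
        _ ≤ D * z := by gcongr; exact le_max_left _ _
    · rw [one_mul]
      exact hV₂.externalGain.monotoneOn (norm_nonneg _) (norm_nonneg _) (WithLp.norm_snd_le _ u)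
  fin_cases i
  · refine max_le (key₁ _ h₀.2.1 h₀.2.2) (le_max_of_le_left ?_)
    exact (le_max_right _ _).trans (le_mul_of_one_le_left hz0 h₀.1)
  · refine max_le (le_max_of_le_left ?_) (key₂ _ h₁.2.1 h₁.2.2)
    exact (le_max_left _ _).trans (le_mul_of_one_le_left hz0 h₁.1)
  · exact max_le (key₁ _ h₂.1 h₂.2.1) (key₂ _ h₂.2.2.1 h₂.2.2.2)

end SmallGain

theorem theorem2 {N₁ N₂ M₁ M₂ : ℕ} (Sys : InterconnectedSystem N₁ N₂ M₁ M₂) (t₀ : ℝ)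
    (V₁ : EuclideanSpace ℝ (Fin N₁) → ℝ) (V₂ : EuclideanSpace ℝ (Fin N₂) → ℝ)
    (c₁ c₂ dh₁ dh₂ γ₁₂ γ₂₁ : ℝ) (γ₁ γ₂ : ℝ → ℝ)
    (hdh₁ : dh₁ ≠ 0) (hdh₂ : dh₂ ≠ 0) (hγ₁₂ : 0 < γ₁₂) (hγ₂₁ : 0 < γ₂₁)
    (hV₁ : IsSubsystemExpISSLyapunov (fun x => x.fst) (fun x => x.snd) Sys.f₁ Sys.g₁ V₁ V₂
      c₁ dh₁ (fun r => γ₁₂ * r) γ₁)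
    (hV₂ : IsSubsystemExpISSLyapunov (fun x => x.snd) (fun x => x.fst) Sys.f₂ Sys.g₂ V₂ V₁
      c₂ dh₂ (fun r => γ₂₁ * r) γ₂)
    (small_gain : γ₁₂ * γ₂₁ < 1) :
    ∃ s₁ : ℝ, 0 < s₁ ∧ ∀ ε : ℝ, 0 < ε →
      let V : EuclideanProd N₁ N₂ → ℝ := fun x => max (1 / s₁ * V₁ x.fst) (V₂ x.snd)
      let c : ℝ := min c₁ c₂
      let d₁ : ℝ := min dh₁ (min (-Real.log (1 / s₁ * γ₁₂)) (-ε))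
      let d₂ : ℝ := min dh₂ (min (-Real.log γ₂₁) (-ε))
      let d₃ : ℝ := min dh₁ (min dh₂ (min (-Real.log (1 / s₁ * γ₁₂)) (-Real.log γ₂₁)))
      let γ : ℝ → ℝ := fun r =>
        max (max (Real.exp d₁) (Real.exp d₂)) (max (Real.exp d₃) 1) *
          max (1 / s₁ * γ₁ r) (γ₂ r)
      IsCandidateExpISSLyapunov Sys.toImpulsiveSystem V γ c ![d₁, d₂, d₃] ∧
      (LocallyLipschitz V₁ → LocallyLipschitz V₂ → LocallyLipschitz V) ∧
      ∀ μ lam : ℝ, 0 < μ → 0 < lam →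
        Sys.toImpulsiveSystem.UniformlyISS t₀ (dwellTimeClass t₀ c ![d₁, d₂, d₃] μ lam) := by

  -- This choice balances the scaled gains: `γ₁₂ / s` and `γ₂₁ * s` both equal the geometric mean of
  -- `γ₁₂` and `γ₂₁`, which is below `1`.
  set s := √(γ₁₂ / γ₂₁) with hs
  have hs0 : 0 < s := Real.sqrt_pos.2 (div_pos hγ₁₂ hγ₂₁)
  have hsq : s * s = γ₁₂ / γ₂₁ := Real.mul_self_sqrt (div_nonneg hγ₁₂.le hγ₂₁.le)
  refine ⟨s, hs0, fun ε hε => ?_⟩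
  intro V c d₁ d₂ d₃ γ
  have hσ : 0 < 1 / s := one_div_pos.2 hs0
  have hρ : 1 / s * γ₁₂ = γ₂₁ * s := by
    have : γ₁₂ = s * s * γ₂₁ := by rw [hsq, div_mul_cancel₀ _ hγ₂₁.ne']
    rw [this]
    field_simp
  have hρ1 : 1 / s * γ₁₂ ≤ 1 := by
    have h1 : (1 / s * γ₁₂) * (1 / s * γ₁₂) = γ₁₂ * γ₂₁ := by
      nth_rewrite 2 [hρ]
      field_simp
    have h2 : 0 < 1 / s * γ₁₂ := by positivity
    nlinarith
  have hρ0 : 0 < 1 / s * γ₁₂ := by positivity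
  have hlog : ∀ e r : ℝ, 0 < r → e ≤ -Real.log r → r ≤ Real.exp (-e) := fun e r hr he => by
    rw [← Real.log_le_iff_le_exp hr]
    linarith
  have hσexp : ∀ e : ℝ, γ₂₁ * s ≤ Real.exp (-e) → γ₂₁ ≤ 1 / s * Real.exp (-e) := fun e he => by
    rw [one_div_mul_eq_div, le_div_iff₀ hs0]
    exact he
  have hd₁ : d₁ ≤ dh₁ ∧ d₁ ≤ -Real.log (1 / s * γ₁₂) ∧ d₁ ≤ -ε := by
    rw [← le_min_iff, ← le_min_iff]
  have hd₂ : d₂ ≤ dh₂ ∧ d₂ ≤ -Real.log γ₂₁ ∧ d₂ ≤ -ε := by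
    rw [← le_min_iff, ← le_min_iff]
  have hd₃ : d₃ ≤ dh₁ ∧ d₃ ≤ dh₂ ∧ d₃ ≤ -Real.log (1 / s * γ₁₂) ∧ d₃ ≤ -Real.log γ₂₁ := by
    rw [← le_min_iff, ← le_min_iff, ← le_min_iff]
  have hone : ∀ e : ℝ, e ≤ -ε → 1 ≤ Real.exp (-e) := fun e he => Real.one_le_exp (by linarith)
  -- The entry `-ε` in `d₁` and `d₂` provides the bound for the component at rest. The scaled second
  -- gain `γ₂₁ * s` is controlled through its equality with `1 / s * γ₁₂`.
  have hjump := jump_max_le hV₁ hV₂ hσ hγ₁₂ (d := ![d₁, d₂, d₃])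
    ⟨hone _ hd₁.2.2, Real.exp_le_exp.2 (neg_le_neg hd₁.1), hlog _ _ hρ0 hd₁.2.1⟩
    ⟨hone _ hd₂.2.2, Real.exp_le_exp.2 (neg_le_neg hd₂.1),
      hσexp _ ((hρ ▸ hρ1).trans (hone _ hd₂.2.2))⟩
    ⟨Real.exp_le_exp.2 (neg_le_neg hd₃.1), hlog _ _ hρ0 hd₃.2.2.1,
      Real.exp_le_exp.2 (neg_le_neg hd₃.2.1), hσexp _ (hρ ▸ hlog _ _ hρ0 hd₃.2.2.1)⟩
  have hC : 1 ≤ max (max (Real.exp d₁) (Real.exp d₂)) (max (Real.exp d₃) 1) :=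
    le_max_of_le_right (le_max_right _ _)
  have hcand : IsCandidateExpISSLyapunov Sys.toImpulsiveSystem V γ c ![d₁, d₂, d₃] := by
    refine isCandidateExpISSLyapunov_max hV₁ hV₂ hσ hρ1 ?_ hC (fun i => ?_) hjump
    · rw [le_div_iff₀ hs0]
      exact hρ ▸ hρ1
    · fin_cases i
      · exact le_max_of_le_left (le_max_left _ _)
      · exact le_max_of_le_left (le_max_right _ _)
      · exact le_max_of_le_right (le_max_left _ _)
  refine ⟨hcand, fun h₁ h₂ => ?_, fun μ lam _ hlam =>
    hcand.uniformlyISS (fun x u i => (hjump x u i).trans (max_le_max le_rfl ?_)) t₀ μ hlam⟩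
  · have hfst := (WithLp.fstL 2 ℝ (EuclideanSpace ℝ (Fin N₁))
      (EuclideanSpace ℝ (Fin N₂))).lipschitz.locallyLipschitz
    have hsnd := (WithLp.sndL 2 ℝ (EuclideanSpace ℝ (Fin N₁))
      (EuclideanSpace ℝ (Fin N₂))).lipschitz.locallyLipschitz
    exact (((lipschitzWith_smul (1 / s)).locallyLipschitz.comp h₁).comp hfst).max (h₂.comp hsnd)
  -- As the prefactor is at least `1`, the max-form jump estimate survives replacing the raw gain by
  -- `γ`.
  · have hnn : 0 ≤ max (1 / s * γ₁ ‖u‖) (γ₂ ‖u‖) :=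
      (hV₂.externalGain.nonneg (norm_nonneg u)).trans (le_max_right _ _)
    exact le_mul_of_one_le_left hnn hC
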